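/- **Theorem (Lavrentiev gap).** Let $\Omega=(-1,1)^2\subset\mathbb R^2$ and let $a(x)=1$ if $|x_1|<|x_2|$, $a(x)=0$ if $|x_1|\ge|x_2|$. An Orlicz function is a convex, left-continuous function $\varphi:[0,\infty)\to[0,\infty]$ with $\varphi(0)=0$, $\lim_{t\to0}\varphi(t)=0$, $\lim_{t\to\infty}\varphi(t)=\infty$; its conjugate is $\varphi^*(s)=\sup_{t\ge0}(st-\varphi(t))$. It satisfies $\Delta_2$ if $\varphi(2t)\le c\,\varphi(t)$ for all $t\ge 0$ with some constant $c$, and $\nabla_2$ if $\varphi^*$ satisfies $\Delta_2$. Let $\varphi,\psi$ be Orlicz functions, both satisfying $\Delta_2$ and $\nabla_2$, and both satisfying the growth condition $-c_0+c_1t^{p_-}\le\varphi(t),\psi(t)\le c_2t^{p_+}+c_0$ for all $t\ge0$, where $1<p_-\le p_+<\infty$, $c_0,c_2\ge0$, $c_1>0$. Assume $\varphi\le c_3\psi+c_4$ for some constants $c_3,c_4\ge 0$, and $\varphi(t)/\psi(t)\to0$ as $t\to\infty$. Put $$\Phi(x,t)=\varphi(t)+a(x)\psi(t),\qquad \Phi^*(x,\cdot)=(\Phi(x,\cdot))^*.$$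 For a generalized Orlicz function $\Theta$ on $\Omega\times[0,\infty)$, $L^{\Theta}(\Omega)$ is the set of measurable vector fields $f:\Omega\to\mathbb R^2$ with finite Luxemburg norm $\|f\|_{L^{\Theta}}=\inf\{\gamma>0:\int_\Omega\Theta(x,|f|/\gamma)\,dx\le1\}$. Define - $W^{1,\Phi}(\Omega)=\{w\in W^{1,1}(\Omega):\nabla w\in L^{\Phi}(\Omega)\}$ with norm $\|w\|_{L^1}+\|\nabla w\|_{L^{\Phi}}$, and $H^{1,\Phi}(\Omega)$ as the closure of $C^\infty(\Omega)\cap W^{1,\Phi}(\Omega)$ in it; - $W^{1,\Phi}_0(\Omega)=\{w\in W^{1,1}_0(\Omega):\nabla w\in L^{\Phi}(\Omega)\}$ with norm $\|\nabla w\|_{L^{\Phi}}$, where $W^{1,1}_0(\Omega)$ is the closure of $C_0^\infty(\Omega)$ in $W^{1,1}(\Omega)$, and $H^{1,\Phi}_0(\Omega)$ as the closure of $C_0^\infty(\Omega)$ in $W^{1,\Phi}_0(\Omega)$. Suppose that, for some $\delta>0$, $$\int_0^\delta\varphi\Big(\frac1r\Big)r\,dr<\infty\qquad\text{and}\qquad\int_0^\delta\psi^*\Big(\frac1r\Big)r\,dr<\infty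 .$$ Then $H^{1,\Phi}(\Omega)\ne W^{1,\Phi}(\Omega)$ and $H^{1,\Phi}_0(\Omega)\ne W^{1,\Phi}_0(\Omega)$. Moreover, there exists $b\in L^{\Phi^*}(\Omega)$ such that the functional $$\mathcal G(u)=\int_\Omega\Phi(x,|\nabla u|)\,dx+\int_\Omega b\cdot\nabla u\,dx$$ has a Lavrentiev gap: $$\inf\mathcal G\big(W^{1,\Phi}_0(\Omega)\big)<\inf\mathcal G\big(H^{1,\Phi}_0(\Omega)\big).$$ -/

import Mathlib

open MeasureTheory Set Filter Topology
open scoped NNReal ENNReal ContDiff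

noncomputable section

namespace DoublePhase

/-! ### Orlicz functions on `[0, ∞)` with values in `[0, ∞]` -/

/-- An Orlicz function: convex, left-continuous, `φ 0 = 0`, `φ t → 0` as `t → 0`
and `φ t → ∞` as `t → ∞`. -/
structure IsOrlicz (φ : ℝ≥0 → ℝ≥0∞) : Prop where
  convex : ConvexOn ℝ≥0 univ φ
  left_cont : ∀ t, ContinuousWithinAt φ (Iio t) t
  map_zero : φ 0 = 0
  tendsto_zero : Tendsto φ (𝓝[>] 0) (𝓝 0)
  tendsto_top : Tendsto φ atTop (𝓝 ⊤)

/-- The conjugate function `φ* s = sup_{t ≥ 0} (s t - φ t)`. The subtraction of `ℝ≥0∞` truncates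
negative values to `0`; this does not change the supremum when `φ 0 = 0`, because `t = 0`
contributes `0`. -/
def conj (φ : ℝ≥0 → ℝ≥0∞) (s : ℝ≥0) : ℝ≥0∞ :=
  ⨆ t : ℝ≥0, ((s * t : ℝ≥0) : ℝ≥0∞) - φ t

/-- The `Δ₂`-condition. -/
def Delta2 (φ : ℝ≥0 → ℝ≥0∞) : Prop :=
  ∃ c : ℝ≥0, ∀ t, φ (2 * t) ≤ c * φ t

/-- The `∇₂`-condition: the conjugate function satisfies the `Δ₂`-condition. -/
def Nabla2 (φ : ℝ≥0 → ℝ≥0∞) : Prop :=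
  Delta2 (conj φ)

/-- Power growth: `-c₀ + c₁ t ^ p ≤ φ t ≤ c₂ t ^ q + c₀` for all `t ≥ 0`, with some `c₀, c₂ ≥ 0`
and `c₁ > 0`. -/
def PowerGrowth (p q : ℝ) (φ : ℝ≥0 → ℝ≥0∞) : Prop :=
  ∃ c₀ c₁ c₂ : ℝ≥0, 0 < c₁ ∧
    ∀ t : ℝ≥0, ((c₁ * t ^ p : ℝ≥0) : ℝ≥0∞) ≤ φ t + c₀ ∧ φ t ≤ ((c₂ * t ^ q + c₀ : ℝ≥0) : ℝ≥0∞)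

/-- Finiteness near the origin of the integral `∫₀ φ (1 / r) r dr`. -/
def FiniteNearZero (φ : ℝ≥0 → ℝ≥0∞) : Prop :=
  ∃ δ : ℝ, 0 < δ ∧
    ∫⁻ r in Ioo (0 : ℝ) δ, φ (Real.toNNReal (1 / r)) * ENNReal.ofReal r < ⊤

/-! ### The checkerboard setting in the plane -/

/-- The Euclidean plane. -/
abbrev Plane : Type := EuclideanSpace ℝ (Fin 2)

/-- The square `(-1, 1)²`. -/
def square : Set Plane :=
  {x | ∀ i, x i ∈ Ioo (-1 : ℝ) 1}

open Classical in
/-- The checkerboard weight: `1` where `|x₁| < |x₂|` and `0` elsewhere. -/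
def weight (x : Plane) : ℝ≥0∞ :=
  if |x 0| < |x 1| then 1 else 0

/-- The integrand `Φ (x, t) = φ t + a x * ψ t`. -/
def integrand (φ ψ : ℝ≥0 → ℝ≥0∞) (x : Plane) (t : ℝ≥0) : ℝ≥0∞ :=
  φ t + weight x * ψ t

/-! ### Generalized Orlicz spaces

Throughout, functions on `Ω` are represented by functions on the plane whose values outside `Ω`
play no role; all the sets of functions below are invariant under equality almost everywhere
on `Ω`. -/

/-- The pointwise conjugate `Φ* (x, ·) = (Φ (x, ·))*`. -/
def conjAt (Φ : Plane → ℝ≥0 → ℝ≥0∞) (x : Plane) : ℝ≥0 → ℝ≥0∞ :=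
  conj (Φ x)

/-- The Luxemburg norm of a vector field on `Ω`
(the infimum of the empty set is `∞`). -/
def luxNorm (Φ : Plane → ℝ≥0 → ℝ≥0∞) (Ω : Set Plane) (f : Plane → Plane) : ℝ≥0∞ :=
  sInf {γ : ℝ≥0∞ | ∃ c : ℝ≥0, 0 < c ∧ γ = c ∧ ∫⁻ x in Ω, Φ x (‖f x‖₊ / c) ≤ 1}

/-- Membership of a vector field in `L^Φ(Ω)`. -/
def MemLPhi (Φ : Plane → ℝ≥0 → ℝ≥0∞) (Ω : Set Plane) (f : Plane → Plane) : Prop :=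
  AEStronglyMeasurable f (volume.restrict Ω) ∧ luxNorm Φ Ω f < ⊤

/-! ### Sobolev and Orlicz-Sobolev spaces -/

/-- Test functions: `C_0^∞(Ω)`. -/
def testFunctions (Ω : Set Plane) : Set (Plane → ℝ) :=
  {η | ContDiff ℝ ∞ η ∧ HasCompactSupport η ∧ tsupport η ⊆ Ω}

/-- `g` is a weak gradient of `w` in `Ω`. -/
def HasWeakGradient (Ω : Set Plane) (w : Plane → ℝ) (g : Plane → Plane) : Prop :=
  LocallyIntegrableOn w Ω ∧ LocallyIntegrableOn g Ω ∧
    ∀ η ∈ testFunctions Ω, ∫ x in Ω, w x • gradient η x = -∫ x in Ω, η x • g x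

open Classical in
/-- The weak gradient of `w` in `Ω` (unique up to null sets); by convention zero if there is
none. -/
def weakGrad (Ω : Set Plane) (w : Plane → ℝ) : Plane → Plane :=
  if h : ∃ g, HasWeakGradient Ω w g then h.choose else 0

/-- The Sobolev space `W^{1,1}(Ω)`. -/
def W11 (Ω : Set Plane) : Set (Plane → ℝ) :=
  {w | IntegrableOn w Ω ∧ ∃ g, HasWeakGradient Ω w g ∧ IntegrableOn g Ω}

/-- The norm of `W^{1,1}(Ω)`. -/
def normW11 (Ω : Set Plane) (w : Plane → ℝ) : ℝ≥0∞ :=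
  eLpNorm w 1 (volume.restrict Ω) + eLpNorm (weakGrad Ω w) 1 (volume.restrict Ω)

/-- `W_0^{1,1}(Ω)`: the closure of `C_0^∞(Ω)` in `W^{1,1}(Ω)`. -/
def W11zero (Ω : Set Plane) : Set (Plane → ℝ) :=
  {w | w ∈ W11 Ω ∧ ∀ ε : ℝ≥0∞, 0 < ε → ∃ η ∈ testFunctions Ω, normW11 Ω (w - η) < ε}

/-- `W^{1,Φ}(Ω)`. -/
def W1Phi (Φ : Plane → ℝ≥0 → ℝ≥0∞) (Ω : Set Plane) : Set (Plane → ℝ) :=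
  {w | w ∈ W11 Ω ∧ MemLPhi Φ Ω (weakGrad Ω w)}

/-- The norm `‖w‖_{L^1} + ‖∇w‖_{L^Φ}` of `W^{1,Φ}(Ω)`. -/
def normW1Phi (Φ : Plane → ℝ≥0 → ℝ≥0∞) (Ω : Set Plane) (w : Plane → ℝ) : ℝ≥0∞ :=
  eLpNorm w 1 (volume.restrict Ω) + luxNorm Φ Ω (weakGrad Ω w)

/-- `H^{1,Φ}(Ω)`: the closure of `C^∞(Ω) ∩ W^{1,Φ}(Ω)` in `W^{1,Φ}(Ω)`. -/
def H1Phi (Φ : Plane → ℝ≥0 → ℝ≥0∞) (Ω : Set Plane) : Set (Plane → ℝ) :=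
  {w | w ∈ W1Phi Φ Ω ∧
    ∀ ε : ℝ≥0∞, 0 < ε → ∃ u, ContDiffOn ℝ ∞ u Ω ∧ u ∈ W1Phi Φ Ω ∧ normW1Phi Φ Ω (w - u) < ε}

/-- `W_0^{1,Φ}(Ω)`. -/
def W1PhiZero (Φ : Plane → ℝ≥0 → ℝ≥0∞) (Ω : Set Plane) : Set (Plane → ℝ) :=
  {w | w ∈ W11zero Ω ∧ MemLPhi Φ Ω (weakGrad Ω w)}

/-- The norm `‖∇w‖_{L^Φ}` of `W_0^{1,Φ}(Ω)`. -/
def normW1PhiZero (Φ : Plane → ℝ≥0 → ℝ≥0∞) (Ω : Set Plane) (w : Plane → ℝ) : ℝ≥0∞ :=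
  luxNorm Φ Ω (weakGrad Ω w)

/-- `H_0^{1,Φ}(Ω)`: the closure of `C_0^∞(Ω)` in `W_0^{1,Φ}(Ω)`. -/
def H1PhiZero (Φ : Plane → ℝ≥0 → ℝ≥0∞) (Ω : Set Plane) : Set (Plane → ℝ) :=
  {w | w ∈ W1PhiZero Φ Ω ∧ ∀ ε : ℝ≥0∞, 0 < ε → ∃ η ∈ testFunctions Ω, normW1PhiZero Φ Ω (w - η) < ε}

/-- The functional `𝒢 w = ∫_Ω Φ(x, |∇w|) dx + ∫_Ω b · ∇w dx`, with values in `(-∞, ∞]`. -/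
def functionalG (Φ : Plane → ℝ≥0 → ℝ≥0∞) (Ω : Set Plane) (b : Plane → Plane)
    (w : Plane → ℝ) : EReal :=
  ((∫⁻ x in Ω, Φ x ‖weakGrad Ω w x‖₊ : ℝ≥0∞) : EReal) +
    ((∫ x in Ω, inner ℝ (b x) (weakGrad Ω w x) : ℝ) : EReal)

end DoublePhase

end

open DoublePhase

namespace DoublePhase

/-! ### Functions that are smooth away from the origin -/

/-! The diagonals split the plane into four cones meeting at a saddle point, the origin. The weight
is `1` in the upper and lower cones and `0` in the left and right ones. Take the competitor w to be
a radial cutoff times a function of the angle that is `1` in the upper cone, `0` in the lower cone,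
and varies only in the side cones. There the larger phase ψ is switched off, so |∇w| of order 1/|x|
costs only ∫ φ(1/|x|) dx. In the upper and lower cones ∇w is bounded. In polar coordinates the first
integrability hypothesis makes ∫ Φ(x, |∇w|) finite (`lintegral_integrand_lt_top`).

Dually, let b be the gradient, turned by a right angle, of an angular step between the left and
right cones. It lives only where the weight is `1`, and is of order 1/|x|. There Φ ≥ ψ, hence Φ* ≤
ψ*, and the second hypothesis makes ∫ Φ*(x, |b|) finite (`lintegral_conjAt_integrand_lt_top`). A
rotated gradient is divergence-free, and the singularity at the origin is too weak to spoil this, so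
∫ b · ∇η = 0 for every test function η (`PunctureSmooth.integral_inner_rot_gradient`).

The two angular gradients are never nonzero at the same point, so b · ∇w reduces to the contribution
of the radial cutoff. That has one sign and is not identically zero
(`integral_inner_rot_gradient_competitor_neg`). By Hölder's inequality u ↦ ∫ b · ∇u is continuous in
the Luxemburg norm, hence vanishes on the closure of the test functions but not at w
(`integral_inner_weakGrad_eq_zero`). For functions smooth only inside the square, the same argument
is applied after multiplication by a second cutoff (`not_mem_H1Phi`). Finally, a large multiple of b
makes the functional negative at w, while on the closure of the test functions it equals ∫ Φ(x,
|∇u|) ≥ 0. -/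

theorem norm_gradient (f : Plane → ℝ) (x : Plane) : ‖gradient f x‖ = ‖fderiv ℝ f x‖ := by
  rw [gradient, LinearIsometryEquiv.norm_map]

theorem inner_gradient (f : Plane → ℝ) (x y : Plane) :
    inner ℝ y (gradient f x) = fderiv ℝ f x y := by
  rw [real_inner_comm, inner_gradient_left]

theorem measurable_gradient (f : Plane → ℝ) : Measurable (gradient f) :=
  (InnerProductSpace.toDual ℝ Plane).symm.continuous.measurable.comp (measurable_fderiv ℝ f)

/-- Functions that are bounded, smooth away from the origin, and whose derivative
is at most of order `1 / |x|`. -/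
structure PunctureSmooth (C : ℝ) (f : Plane → ℝ) : Prop where
  smooth : ∀ x, x ≠ 0 → ContDiffAt ℝ ∞ f x
  bound : ∀ x, |f x| ≤ C
  fderiv_bound : ∀ x, ‖x‖ * ‖fderiv ℝ f x‖ ≤ C

namespace PunctureSmooth

variable {C D : ℝ} {f g : Plane → ℝ}

theorem nonneg (hf : PunctureSmooth C f) : 0 ≤ C := (abs_nonneg _).trans (hf.bound 0)

theorem differentiableAt (hf : PunctureSmooth C f) {x : Plane} (hx : x ≠ 0) :
    DifferentiableAt ℝ f x := (hf.smooth x hx).differentiableAt (by simp)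

theorem fderiv_mul (hf : PunctureSmooth C f) (hg : PunctureSmooth D g) {x : Plane} (hx : x ≠ 0) :
    fderiv ℝ (fun y => f y * g y) x = f x • fderiv ℝ g x + g x • fderiv ℝ f x :=
  _root_.fderiv_fun_mul (hf.differentiableAt hx) (hg.differentiableAt hx)

theorem mul (hf : PunctureSmooth C f) (hg : PunctureSmooth D g) :
    PunctureSmooth (2 * C * D) (fun x => f x * g x) := by
  have hC := hf.nonneg
  have hD := hg.nonneg
  refine ⟨fun x hx => (hf.smooth x hx).mul (hg.smooth x hx), fun x => ?_, fun x => ?_⟩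
  · rw [abs_mul]
    have := mul_le_mul (hf.bound x) (hg.bound x) (abs_nonneg _) hC
    nlinarith [mul_nonneg hC hD]
  · rcases eq_or_ne x 0 with rfl | hx
    · simp; positivity
    rw [hf.fderiv_mul hg hx]
    calc ‖x‖ * ‖f x • fderiv ℝ g x + g x • fderiv ℝ f x‖
        ≤ ‖x‖ * (|f x| * ‖fderiv ℝ g x‖ + |g x| * ‖fderiv ℝ f x‖) := by
          gcongr
          refine (norm_add_le _ _).trans ?_
          rw [norm_smul, norm_smul, Real.norm_eq_abs, Real.norm_eq_abs]
      _ = |f x| * (‖x‖ * ‖fderiv ℝ g x‖) + |g x| * (‖x‖ * ‖fderiv ℝ f x‖) := by ring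
      _ ≤ C * D + D * C := by
          gcongr
          · exact hf.bound x
          · exact hg.fderiv_bound x
          · exact hg.bound x
          · exact hf.fderiv_bound x
      _ = 2 * C * D := by ring

theorem const_mul (hf : PunctureSmooth C f) (a : ℝ) :
    PunctureSmooth (|a| * C) (fun x => a * f x) := by
  refine ⟨fun x hx => contDiffAt_const.mul (hf.smooth x hx), fun x => ?_, fun x => ?_⟩
  · rw [abs_mul]
    exact mul_le_mul_of_nonneg_left (hf.bound x) (abs_nonneg a)
  · rcases eq_or_ne x 0 with rfl | hx
    · simpa using mul_nonneg (abs_nonneg a) hf.nonneg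
    rw [fderiv_const_mul (hf.differentiableAt hx), norm_smul, Real.norm_eq_abs, mul_left_comm]
    exact mul_le_mul_of_nonneg_left (hf.fderiv_bound x) (abs_nonneg a)

/-- The bound on `‖x‖ * ‖fderiv ℝ f x‖` is scale-invariant, so the constant does not change. This
makes cutoffs at all scales uniformly controlled. -/
theorem comp_smul (hf : PunctureSmooth C f) {k : ℝ} (hk : 0 < k) :
    PunctureSmooth C (fun x => f (k • x)) := by
  refine ⟨fun x hx => ?_, fun x => hf.bound _, fun x => ?_⟩
  · exact (hf.smooth (k • x) (smul_ne_zero hk.ne' hx)).comp x (contDiffAt_id.const_smul k)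
  · rw [fderiv_comp_smul, norm_smul, ← mul_assoc, mul_comm ‖x‖, ← norm_smul]
    exact hf.fderiv_bound _

theorem aestronglyMeasurable (hf : PunctureSmooth C f) (μ : Measure Plane)
    [NullSingletonClass μ] : AEStronglyMeasurable f μ := by
  have h : ContinuousOn f {0}ᶜ := fun x hx => (hf.smooth x hx).continuousAt.continuousWithinAt
  have := h.aestronglyMeasurable (μ := μ) (measurableSet_singleton 0).compl
  rwa [restrict_compl_singleton] at this

theorem norm_fderiv_le (hf : PunctureSmooth C f) {x : Plane} (hx : x ≠ 0) :
    ‖fderiv ℝ f x‖ ≤ C * ‖x‖⁻¹ := by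
  rw [← div_eq_mul_inv, le_div_iff₀ (norm_pos_iff.2 hx), mul_comm]
  exact hf.fderiv_bound x

end PunctureSmooth

theorem punctureSmooth_of_contDiff {f : Plane → ℝ} (hf : ContDiff ℝ ∞ f)
    (hc : HasCompactSupport f) : ∃ C, PunctureSmooth C f := by
  obtain ⟨C, hC⟩ := hc.exists_bound_of_continuous hf.continuous
  have hd : Continuous fun x : Plane => ‖x‖ • fderiv ℝ f x :=
    continuous_norm.smul (hf.continuous_fderiv (by simp))
  obtain ⟨D, hD⟩ := (hc.fderiv ℝ).smul_left (f := fun x : Plane => ‖x‖)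
    |>.exists_bound_of_continuous hd
  refine ⟨max C D, fun x _ => hf.contDiffAt, fun x => (hC x).trans (le_max_left _ _), fun x => ?_⟩
  refine le_trans ?_ ((hD x).trans (le_max_right _ _))
  simp [norm_smul]

/-! ### Radial cutoffs -/

/-- A radial cutoff function. -/
noncomputable def cutoff (a : ℝ) (x : Plane) : ℝ := Real.smoothTransition (a - 4 * ‖x‖ ^ 2)

theorem cutoff_contDiff (a : ℝ) : ContDiff ℝ ∞ (cutoff a) :=
  Real.smoothTransition.contDiff.comp
    (contDiff_const.sub (contDiff_const.mul (contDiff_norm_sq ℝ)))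

theorem cutoff_eq_one {a : ℝ} {x : Plane} (h : 4 * ‖x‖ ^ 2 ≤ a - 1) : cutoff a x = 1 :=
  Real.smoothTransition.one_of_one_le (by linarith)

theorem cutoff_eq_zero {a : ℝ} {x : Plane} (h : a ≤ 4 * ‖x‖ ^ 2) : cutoff a x = 0 :=
  Real.smoothTransition.zero_of_nonpos (by linarith)

theorem tsupport_cutoff {a : ℝ} : tsupport (cutoff a) ⊆ {x | 4 * ‖x‖ ^ 2 ≤ a} := by
  refine closure_minimal (fun x hx => ?_) (isClosed_le (by fun_prop) continuous_const)
  by_contra h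
  exact hx (cutoff_eq_zero (le_of_lt (not_le.1 h)))

theorem cutoff_hasCompactSupport (a : ℝ) : HasCompactSupport (cutoff a) := by
  refine HasCompactSupport.of_support_subset_isCompact
    (isCompact_closedBall (0 : Plane) (|a| + 1)) fun x hx => ?_
  by_contra h
  refine hx (cutoff_eq_zero ?_)
  have h1 : |a| + 1 < ‖x‖ := by simpa using h
  nlinarith [le_abs_self a, abs_nonneg a]

/-! ### Removing the singularity at the origin -/

theorem lintegral_inv_norm_ball (R : ℝ) :
    ∫⁻ x in Metric.ball (0 : Plane) R, ENNReal.ofReal ‖x‖⁻¹ < ⊤ := by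
  have h : IntegrableOn (fun x : Plane => ‖x‖⁻¹) (Metric.ball 0 R) := by
    rw [integrableOn_fun_norm_addHaar volume (f := fun r : ℝ => r⁻¹)]
    refine (integrableOn_const (C := (1 : ℝ)) (by simp)).congr_fun (fun r hr => ?_)
      measurableSet_Ioo
    simp [hr.1.ne']
  exact h.lintegral_lt_top

theorem tendsto_lintegral_inv_norm_closedBall :
    Tendsto (fun n : ℕ => ∫⁻ x in Metric.closedBall (0 : Plane) ((n : ℝ) + 1)⁻¹,
      ENNReal.ofReal ‖x‖⁻¹) atTop (𝓝 0) := by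
  have h := tendsto_setLIntegral_zero (μ := volume.restrict (Metric.ball (0 : Plane) 2))
    (lintegral_inv_norm_ball 2).ne (l := atTop)
    (s := fun n : ℕ => Metric.closedBall (0 : Plane) ((n : ℝ) + 1)⁻¹) ?_
  · refine h.congr fun n => ?_
    rw [Measure.restrict_restrict measurableSet_closedBall, inter_eq_left.2]
    refine Metric.closedBall_subset_ball ?_
    have : ((n : ℝ) + 1)⁻¹ ≤ 1 := inv_le_one_of_one_le₀ (by linarith [n.cast_nonneg (α := ℝ)])
    linarith
  · refine tendsto_of_tendsto_of_tendsto_of_le_of_le tendsto_const_nhds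
      (h := fun n : ℕ => volume (Metric.closedBall (0 : Plane) ((n : ℝ) + 1)⁻¹)) ?_
      (fun _ => zero_le) (fun n => Measure.restrict_apply_le _ _)
    simp only [Measure.addHaar_closedBall volume (0 : Plane)
      (inv_nonneg.2 (Nat.cast_add_one_pos _).le)]
    have h1 : Tendsto (fun n : ℕ => ENNReal.ofReal (((n : ℝ) + 1)⁻¹ ^ Module.finrank ℝ Plane))
        atTop (𝓝 0) := by
      rw [← ENNReal.ofReal_zero]
      refine ENNReal.tendsto_ofReal ?_
      have h2 : Tendsto (fun n : ℕ => ((n : ℝ) + 1)⁻¹) atTop (𝓝 0) := by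
        simpa using tendsto_one_div_add_atTop_nhds_zero_nat (𝕜 := ℝ)
      simpa using h2.pow 2
    simpa using ENNReal.Tendsto.mul_const h1 (Or.inr (measure_ball_lt_top (μ := volume)
      (x := (0 : Plane)) (r := 1)).ne)

/-- Subtract from `f` its product with a cutoff to a disc of radius 1/k. The error lives in that
disc, with value and gradient at most `D` and `D / |x|`, and `1 / |x|` is integrable in the plane,
so the error tends to zero in W^{1,1}. -/
theorem PunctureSmooth.exists_approx {C : ℝ} {f : Plane → ℝ} (hf : PunctureSmooth C f)
    {ε : ℝ≥0∞} (hε : 0 < ε) :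
    ∃ g : Plane → ℝ, ContDiff ℝ ∞ g ∧ Function.support g ⊆ Function.support f ∧
      (∃ D, PunctureSmooth D (f - g)) ∧
      (∫⁻ x, ‖(f - g) x‖ₑ) + ∫⁻ x, ‖gradient (f - g) x‖ₑ < ε := by
  obtain ⟨A, hA⟩ := punctureSmooth_of_contDiff (cutoff_contDiff 2) (cutoff_hasCompactSupport 2)
  set D := 2 * C * A with hD
  -- `D` does not depend on `n`, by dilation invariance of the cutoff's constant.
  have key : ∀ n : ℕ, PunctureSmooth D (fun x => f x * cutoff 2 (((n : ℝ) + 1) • x)) := fun n =>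
    hf.mul (hA.comp_smul (Nat.cast_add_one_pos n))
  have hD0 : 0 ≤ D := (key 0).nonneg
  have hlim := ENNReal.Tendsto.const_mul (a := ENNReal.ofReal (2 * D))
    tendsto_lintegral_inv_norm_closedBall (Or.inr ENNReal.ofReal_ne_top)
  rw [mul_zero] at hlim
  obtain ⟨n, hn⟩ := (hlim.eventually (gt_mem_nhds hε)).exists
  have hk : (0 : ℝ) < n + 1 := Nat.cast_add_one_pos n
  set k : ℝ := n + 1 with hkdef
  have hk1 : 1 ≤ k := by rw [hkdef]; linarith [n.cast_nonneg (α := ℝ)]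
  set e : Plane → ℝ := fun x => f x * cutoff 2 (k • x) with he
  have hfe : f - (f - e) = e := by simp
  have hzero : ∀ x, x ∉ Metric.closedBall (0 : Plane) k⁻¹ → e =ᶠ[𝓝 x] 0 := by
    intro x hx
    filter_upwards [Metric.isClosed_closedBall.isOpen_compl.mem_nhds hx] with y hy
    have hy' : k⁻¹ < ‖y‖ := by simpa using hy
    have : 1 < ‖k • y‖ := by
      rw [norm_smul, Real.norm_of_nonneg hk.le]
      rwa [inv_lt_iff_one_lt_mul₀ hk, mul_comm] at hy'
    simp only [he, Pi.zero_apply]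
    rw [cutoff_eq_zero (by nlinarith), mul_zero]
  refine ⟨f - e, ?_, ?_, ⟨D, hfe.symm ▸ key n⟩, ?_⟩
  · rw [contDiff_iff_contDiffAt]
    intro x
    rcases eq_or_ne x 0 with rfl | hx
    · refine (contDiffAt_const (c := (0 : ℝ))).congr_of_eventuallyEq ?_
      filter_upwards [Metric.ball_mem_nhds (0 : Plane) (ε := (2 * k)⁻¹) (by positivity)] with y hy
      have hy' : ‖y‖ < (2 * k)⁻¹ := by simpa using hy
      have : ‖k • y‖ < 1 / 2 := by
        rw [norm_smul, Real.norm_of_nonneg hk.le]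
        calc k * ‖y‖ < k * (2 * k)⁻¹ := by gcongr
          _ = 1 / 2 := by field_simp
      simp only [he, Pi.sub_apply]
      rw [cutoff_eq_one (by nlinarith [norm_nonneg (k • y)])]
      ring
    · exact (hf.smooth x hx).sub ((key n).smooth x hx)
  · intro x hx hfx
    exact hx (by simp [he, hfx])
  · rw [hfe]
    refine lt_of_le_of_lt ?_ hn
    have h1 : ∫⁻ x, ‖e x‖ₑ ≤ ENNReal.ofReal D *
        ∫⁻ x in Metric.closedBall (0 : Plane) k⁻¹, ENNReal.ofReal ‖x‖⁻¹ := by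
      rw [← lintegral_const_mul' _ _ ENNReal.ofReal_ne_top,
        ← lintegral_indicator measurableSet_closedBall]
      refine lintegral_mono_ae ?_
      filter_upwards [Measure.ae_ne volume (0 : Plane)] with x hx0
      by_cases hx : x ∈ Metric.closedBall (0 : Plane) k⁻¹
      · rw [indicator_of_mem hx, ← ENNReal.ofReal_mul hD0, ← ofReal_norm]
        refine ENNReal.ofReal_le_ofReal ?_
        have hxk : ‖x‖ ≤ k⁻¹ := by simpa using hx
        have : 1 ≤ ‖x‖⁻¹ := by
          rw [one_le_inv₀ (norm_pos_iff.2 hx0)]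
          exact hxk.trans (inv_le_one_of_one_le₀ hk1)
        exact ((key n).bound x).trans (le_mul_of_one_le_right hD0 this)
      · rw [(hzero x hx).eq_of_nhds]; simp
    have h2 : ∫⁻ x, ‖gradient e x‖ₑ ≤ ENNReal.ofReal D *
        ∫⁻ x in Metric.closedBall (0 : Plane) k⁻¹, ENNReal.ofReal ‖x‖⁻¹ := by
      rw [← lintegral_const_mul' _ _ ENNReal.ofReal_ne_top,
        ← lintegral_indicator measurableSet_closedBall]
      refine lintegral_mono_ae ?_
      filter_upwards [Measure.ae_ne volume (0 : Plane)] with x hx0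
      by_cases hx : x ∈ Metric.closedBall (0 : Plane) k⁻¹
      · rw [indicator_of_mem hx, ← ENNReal.ofReal_mul hD0, ← ofReal_norm, norm_gradient]
        exact ENNReal.ofReal_le_ofReal ((key n).norm_fderiv_le hx0)
      · rw [(hzero x hx).gradient_eq]
        have : gradient (0 : Plane → ℝ) x = 0 := gradient_const x 0
        simp [this]
    calc _ ≤ _ := add_le_add h1 h2
      _ = _ := by rw [← add_mul, ← ENNReal.ofReal_add hD0 hD0, ← two_mul]

theorem integral_fderiv_eq_zero_of_contDiff {f : Plane → ℝ} (hf : ContDiff ℝ ∞ f)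
    (hc : HasCompactSupport f) (v : Plane) : ∫ x, fderiv ℝ f x v = 0 := by
  have hcd : Continuous fun x => fderiv ℝ f x v :=
    (hf.continuous_fderiv (by simp)).clm_apply continuous_const
  have := integral_mul_fderiv_eq_neg_fderiv_mul_of_integrable (μ := (volume : Measure Plane))
    (f := fun _ => (1 : ℝ)) (g := f) (v := v) (by simp)
    (by simpa using hcd.integrable_of_hasCompactSupport (hc.fderiv_apply ℝ v))
    (by simpa using hf.continuous.integrable_of_hasCompactSupport hc)
    (fun x _ => differentiableAt_const _) (fun x _ => hf.differentiable (by simp) x)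
  simpa using this

theorem PunctureSmooth.integrable_gradient {C : ℝ} {f : Plane → ℝ} (hf : PunctureSmooth C f)
    (hc : HasCompactSupport f) : Integrable (gradient f) := by
  refine ⟨(measurable_gradient f).aestronglyMeasurable, ?_⟩
  obtain ⟨R, hR⟩ := hc.isCompact.isBounded.subset_ball (0 : Plane)
  refine lt_of_le_of_lt ?_ (ENNReal.mul_lt_top (ENNReal.ofReal_lt_top (r := C))
    (lintegral_inv_norm_ball R))
  rw [← lintegral_const_mul' _ _ ENNReal.ofReal_ne_top,
        ← lintegral_indicator measurableSet_ball]
  refine lintegral_mono_ae ?_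
  filter_upwards [Measure.ae_ne volume (0 : Plane)] with x hx0
  by_cases hx : x ∈ Metric.ball (0 : Plane) R
  · rw [indicator_of_mem hx, ← ENNReal.ofReal_mul hf.nonneg, ← ofReal_norm, norm_gradient]
    exact ENNReal.ofReal_le_ofReal (hf.norm_fderiv_le hx0)
  · have : fderiv ℝ f x = 0 := by
      by_contra h
      exact hx (hR (support_fderiv_subset ℝ h))
    rw [← ofReal_norm, norm_gradient, this]
    simp

/-- Integration by parts ignores the puncture: the identity holds for the smooth approximations, and
gradients converge in L^1. -/
theorem PunctureSmooth.integral_fderiv_eq_zero {C : ℝ} {f : Plane → ℝ} (hf : PunctureSmooth C f)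
    (hc : HasCompactSupport f) (v : Plane) : ∫ x, fderiv ℝ f x v = 0 := by
  have key : ∀ ε : ℝ, 0 < ε → ‖∫ x, fderiv ℝ f x v‖ ≤ ‖v‖ * ε := by
    intro ε hε
    obtain ⟨g, hg, hgs, ⟨D, hD⟩, hlt⟩ := hf.exists_approx (ENNReal.ofReal_pos.2 hε)
    have hgc : HasCompactSupport g := hc.mono hgs
    obtain ⟨B, hB⟩ := punctureSmooth_of_contDiff hg hgc
    have hi : ∀ {E : ℝ} {h : Plane → ℝ}, PunctureSmooth E h → HasCompactSupport h →
        Integrable fun x => fderiv ℝ h x v := by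
      intro E h hh hhc
      simpa only [inner_gradient] using (hh.integrable_gradient hhc).const_inner (𝕜 := ℝ) v
    have hfgc : HasCompactSupport (f - g) := hc.sub hgc
    have h1 : ∫ x, fderiv ℝ f x v = ∫ x, fderiv ℝ (f - g) x v := by
      rw [← sub_zero (∫ x, fderiv ℝ f x v), ← integral_fderiv_eq_zero_of_contDiff hg hgc v,
        ← integral_sub (hi hf hc) (hi hB hgc)]
      refine integral_congr_ae ?_
      filter_upwards [Measure.ae_ne volume (0 : Plane)] with x hx0
      rw [fderiv_sub (hf.differentiableAt hx0) (hB.differentiableAt hx0)]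
      rfl
    rw [h1]
    calc ‖∫ x, fderiv ℝ (f - g) x v‖ ≤ ∫ x, ‖v‖ * ‖gradient (f - g) x‖ := by
          refine norm_integral_le_of_norm_le ((hD.integrable_gradient hfgc).norm.const_mul _)
            (.of_forall fun x => ?_)
          rw [norm_gradient, mul_comm]
          exact ContinuousLinearMap.le_opNorm _ _
      _ = ‖v‖ * ∫ x, ‖gradient (f - g) x‖ := integral_const_mul _ _
      _ ≤ ‖v‖ * ε := by
          gcongr
          rw [integral_norm_eq_lintegral_enorm (measurable_gradient _).aestronglyMeasurable]
          exact ENNReal.toReal_le_of_le_ofReal hε.le ((le_add_self).trans hlt.le)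
  by_contra h
  have hpos : 0 < ‖∫ x, fderiv ℝ f x v‖ := norm_pos_iff.2 h
  have h2 := key (‖∫ x, fderiv ℝ f x v‖ / (2 * (‖v‖ + 1))) (by positivity)
  have h3 : ‖v‖ * (‖∫ x, fderiv ℝ f x v‖ / (2 * (‖v‖ + 1))) ≤ ‖∫ x, fderiv ℝ f x v‖ / 2 := by
    rw [mul_div_assoc', div_le_div_iff₀ (by positivity) (by positivity)]
    nlinarith
  linarith

/-! ### Weak gradients -/

theorem integrable_test_smul {Ω : Set Plane} {η : Plane → ℝ} (hη : η ∈ testFunctions Ω)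
    {g : Plane → Plane} (hg : LocallyIntegrableOn g Ω) :
    IntegrableOn (fun x => η x • g x) Ω := by
  obtain ⟨h1, h2, h3⟩ := hη
  have hK : IntegrableOn (fun x => η x • g x) (tsupport η) :=
    (hg.integrableOn_compact_subset h3 h2).continuousOn_smul h1.continuous.continuousOn h2
  rw [integrableOn_iff_integrable_of_support_subset] at hK
  · exact hK.integrableOn
  · exact (Function.support_smul_subset_left _ _).trans (subset_tsupport η)

theorem integrable_smul_gradient_test {Ω : Set Plane} {η : Plane → ℝ} (hη : η ∈ testFunctions Ω)
    {w : Plane → ℝ} (hw : LocallyIntegrableOn w Ω) :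
    IntegrableOn (fun x => w x • gradient η x) Ω := by
  obtain ⟨h1, h2, h3⟩ := hη
  have hc : Continuous (gradient η) :=
    (InnerProductSpace.toDual ℝ Plane).symm.continuous.comp (h1.continuous_fderiv (by simp))
  have hK : IntegrableOn (fun x => w x • gradient η x) (tsupport η) :=
    (hw.integrableOn_compact_subset h3 h2).smul_continuousOn hc.continuousOn h2
  rw [integrableOn_iff_integrable_of_support_subset] at hK
  · exact hK.integrableOn
  · intro x hx
    refine support_fderiv_subset ℝ (f := η) fun h => hx ?_
    simp [gradient, h]

theorem HasWeakGradient.weakGrad {Ω : Set Plane} {w : Plane → ℝ} {g : Plane → Plane}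
    (h : HasWeakGradient Ω w g) : HasWeakGradient Ω w (weakGrad Ω w) := by
  have hex : ∃ g, HasWeakGradient Ω w g := ⟨g, h⟩
  rw [DoublePhase.weakGrad, dif_pos hex]
  exact hex.choose_spec

/-- Uniqueness of weak gradients by the fundamental lemma of the calculus of variations. It replaces
the arbitrary choice in `weakGrad` by an explicit gradient. -/
theorem weakGrad_ae_eq {Ω : Set Plane} (hΩ : IsOpen Ω) {w : Plane → ℝ} {g : Plane → Plane}
    (h : HasWeakGradient Ω w g) : weakGrad Ω w =ᵐ[volume.restrict Ω] g := by
  have hw := h.weakGrad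
  have := hΩ.ae_eq_zero_of_integral_contDiff_smul_eq_zero (μ := volume)
    (hw.2.1.sub h.2.1) fun η h1 h2 h3 => ?_
  · rw [Filter.EventuallyEq, ae_restrict_iff' hΩ.measurableSet]
    filter_upwards [this] with x hx hxΩ
    exact sub_eq_zero.1 (hx hxΩ)
  · have hη : η ∈ testFunctions Ω := ⟨h1, h2, h3⟩
    rw [← setIntegral_eq_integral_of_forall_compl_eq_zero (s := Ω)]
    · simp only [Pi.sub_apply, smul_sub]
      rw [integral_sub (integrable_test_smul hη hw.2.1) (integrable_test_smul hη h.2.1),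
        sub_eq_zero, ← neg_inj, ← hw.2.2 η hη, ← h.2.2 η hη]
    · intro x hx
      rw [image_eq_zero_of_notMem_tsupport fun h => hx (h3 h), zero_smul]

theorem HasWeakGradient.sub {Ω : Set Plane} {w u : Plane → ℝ} {g h : Plane → Plane}
    (hw : HasWeakGradient Ω w g) (hu : HasWeakGradient Ω u h) :
    HasWeakGradient Ω (w - u) (g - h) := by
  refine ⟨hw.1.sub hu.1, hw.2.1.sub hu.2.1, fun η hη => ?_⟩
  simp only [Pi.sub_apply, sub_smul, smul_sub]
  rw [integral_sub (integrable_smul_gradient_test hη hw.1) (integrable_smul_gradient_test hη hu.1),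
    integral_sub (integrable_test_smul hη hw.2.1) (integrable_test_smul hη hu.2.1),
    hw.2.2 η hη, hu.2.2 η hη]
  abel

/-- By the product rule, the defining identity says exactly that the derivatives of `η * f`
integrate to zero. The smooth and the punctured cases then differ only in how that is verified. -/
theorem hasWeakGradient_gradient {Ω : Set Plane} {f : Plane → ℝ}
    (hd : ∀ᵐ x ∂volume.restrict Ω, DifferentiableAt ℝ f x)
    (hf : LocallyIntegrableOn f Ω) (hg : LocallyIntegrableOn (gradient f) Ω)
    (h : ∀ η ∈ testFunctions Ω, ∀ v, ∫ x in Ω, fderiv ℝ (fun y => η y * f y) x v = 0) :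
    HasWeakGradient Ω f (gradient f) := by
  refine ⟨hf, hg, fun η hη => ?_⟩
  have h1 := integrable_smul_gradient_test hη hf
  have h2 := integrable_test_smul hη hg
  rw [← add_eq_zero_iff_eq_neg, ← integral_add h1 h2]
  refine ext_inner_left ℝ fun v => ?_
  have h12 : Integrable (fun x => f x • gradient η x + η x • gradient f x)
      (volume.restrict Ω) := h1.add h2
  rw [← integral_inner h12, inner_zero_right, ← h η hη v]
  refine integral_congr_ae ?_
  filter_upwards [hd] with x hx
  rw [fderiv_fun_mul (hη.1.differentiable (by simp) x) hx]
  simp only [inner_add_right, inner_smul_right, inner_gradient]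
  simp
  ring

theorem test_mul_contDiff {Ω : Set Plane} (hΩ : IsOpen Ω) {η u : Plane → ℝ}
    (hη : η ∈ testFunctions Ω) (hu : ContDiffOn ℝ ∞ u Ω) :
    (fun x => η x * u x) ∈ testFunctions Ω := by
  obtain ⟨h1, h2, h3⟩ := hη
  have hsub : tsupport (fun x => η x * u x) ⊆ tsupport η := tsupport_mul_subset_left
  refine ⟨?_, h2.mul_right, hsub.trans h3⟩
  rw [contDiff_iff_contDiffAt]
  intro x
  by_cases hx : x ∈ tsupport η
  · exact h1.contDiffAt.mul (hu.contDiffAt (hΩ.mem_nhds (h3 hx)))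
  · refine (contDiffAt_const (c := (0 : ℝ))).congr_of_eventuallyEq ?_
    filter_upwards [(isClosed_tsupport η).isOpen_compl.mem_nhds hx] with y hy
    rw [image_eq_zero_of_notMem_tsupport hy, zero_mul]

theorem setIntegral_fderiv_eq {Ω : Set Plane} {F : Plane → ℝ} (hF : tsupport F ⊆ Ω) (v : Plane) :
    ∫ x in Ω, fderiv ℝ F x v = ∫ x, fderiv ℝ F x v := by
  refine setIntegral_eq_integral_of_forall_compl_eq_zero fun x hx => ?_
  by_contra h
  refine hx (hF (support_fderiv_subset ℝ (f := F) fun h0 => h ?_))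
  simp [h0]

theorem hasWeakGradient_of_contDiffOn {Ω : Set Plane} (hΩ : IsOpen Ω) {u : Plane → ℝ}
    (hu : ContDiffOn ℝ ∞ u Ω) : HasWeakGradient Ω u (gradient u) := by
  have hcg : ContinuousOn (gradient u) Ω :=
    (InnerProductSpace.toDual ℝ Plane).symm.continuous.comp_continuousOn
      (hu.continuousOn_fderiv_of_isOpen hΩ (by simp))
  refine hasWeakGradient_gradient ?_ (hu.continuousOn.locallyIntegrableOn hΩ.measurableSet)
    (hcg.locallyIntegrableOn hΩ.measurableSet) fun η hη v => ?_
  · filter_upwards [ae_restrict_mem hΩ.measurableSet] with x hx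
    exact (hu.contDiffAt (hΩ.mem_nhds hx)).differentiableAt (by simp)
  · obtain ⟨h1, h2, h3⟩ := test_mul_contDiff hΩ hη hu
    rw [setIntegral_fderiv_eq h3, integral_fderiv_eq_zero_of_contDiff h1 h2]

theorem PunctureSmooth.locallyIntegrable {C : ℝ} {f : Plane → ℝ} (hf : PunctureSmooth C f) :
    LocallyIntegrable f :=
  (locallyIntegrable_const C).mono (hf.aestronglyMeasurable _)
    (.of_forall fun x => (hf.bound x).trans (le_abs_self C))

theorem PunctureSmooth.locallyIntegrable_gradient {C : ℝ} {f : Plane → ℝ}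
    (hf : PunctureSmooth C f) : LocallyIntegrable (gradient f) := by
  have h : LocallyIntegrable fun x : Plane => C * ‖x‖⁻¹ := by
    intro x
    refine ⟨Metric.ball 0 (‖x‖ + 1), Metric.isOpen_ball.mem_nhds (by simp), ?_⟩
    refine Integrable.const_mul ⟨by fun_prop, ?_⟩ C
    refine lt_of_le_of_lt (le_of_eq ?_) (lintegral_inv_norm_ball (‖x‖ + 1))
    refine lintegral_congr fun y => ?_
    rw [← ofReal_norm, Real.norm_of_nonneg (by positivity)]
  refine h.mono (measurable_gradient f).aestronglyMeasurable ?_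
  filter_upwards [Measure.ae_ne volume (0 : Plane)] with x hx0
  rw [norm_gradient]
  exact (hf.norm_fderiv_le hx0).trans (le_abs_self _)

theorem PunctureSmooth.hasWeakGradient {C : ℝ} {f : Plane → ℝ}
    (hf : PunctureSmooth C f) (Ω : Set Plane) : HasWeakGradient Ω f (gradient f) := by
  refine hasWeakGradient_gradient ?_ (hf.locallyIntegrable.locallyIntegrableOn _)
    (hf.locallyIntegrable_gradient.locallyIntegrableOn _) fun η hη v => ?_
  · filter_upwards [ae_restrict_of_ae (Measure.ae_ne volume (0 : Plane))] with x hx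
    exact hf.differentiableAt hx
  · obtain ⟨D, hD⟩ := punctureSmooth_of_contDiff hη.1 hη.2.1
    have hsub : tsupport (fun x => η x * f x) ⊆ tsupport η := tsupport_mul_subset_left
    rw [setIntegral_fderiv_eq (hsub.trans hη.2.2),
      (hD.mul hf).integral_fderiv_eq_zero hη.2.1.mul_right]

theorem PunctureSmooth.mem_W11zero {C : ℝ} {f : Plane → ℝ} (hf : PunctureSmooth C f)
    {Ω : Set Plane} (hΩ : IsOpen Ω) (hc : HasCompactSupport f) (hs : tsupport f ⊆ Ω) :
    f ∈ W11zero Ω := by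
  refine ⟨⟨?_, gradient f, hf.hasWeakGradient Ω, (hf.integrable_gradient hc).integrableOn⟩,
    fun ε hε => ?_⟩
  · have := hf.locallyIntegrable.integrableOn_isCompact hc
    rw [integrableOn_iff_integrable_of_support_subset (subset_tsupport f)] at this
    exact this.integrableOn
  · obtain ⟨g, hg, hgs, ⟨D, hD⟩, hlt⟩ := hf.exists_approx hε
    refine ⟨g, ⟨hg, hc.mono hgs, (closure_mono hgs).trans hs⟩, lt_of_le_of_lt ?_ hlt⟩
    rw [normW11, eLpNorm_congr_ae (weakGrad_ae_eq hΩ (hD.hasWeakGradient Ω)),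
      eLpNorm_one_eq_lintegral_enorm, eLpNorm_one_eq_lintegral_enorm]
    exact add_le_add (setLIntegral_le_lintegral _ _) (setLIntegral_le_lintegral _ _)

/-! ### The competitor and the solenoidal field -/

/-- A smooth step in the angle: `1` on the cone around the positive `i`-th half-axis and
`0` on the opposite cone. -/
noncomputable def angularStep (i : Fin 2) (x : Plane) : ℝ :=
  Real.smoothTransition ((√2 * (x i / ‖x‖) + 1) / 2)

theorem angularStep_nonneg (i : Fin 2) (x : Plane) : 0 ≤ angularStep i x :=
  Real.smoothTransition.nonneg _

theorem angularStep_le_one (i : Fin 2) (x : Plane) : angularStep i x ≤ 1 :=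
  Real.smoothTransition.le_one _

theorem contDiffAt_angle (i : Fin 2) {x : Plane} (hx : x ≠ 0) :
    ContDiffAt ℝ ∞ (fun y : Plane => y i / ‖y‖) x :=
  (EuclideanSpace.proj (𝕜 := ℝ) i).contDiff.contDiffAt.div (contDiffAt_norm ℝ hx)
    (norm_ne_zero_iff.2 hx)

theorem angularStep_contDiffAt (i : Fin 2) {x : Plane} (hx : x ≠ 0) :
    ContDiffAt ℝ ∞ (angularStep i) x :=
  ContDiffAt.comp (f := fun y : Plane => (√2 * (y i / ‖y‖) + 1) / 2) x
    Real.smoothTransition.contDiff.contDiffAt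
    (((contDiffAt_const.mul (contDiffAt_angle i hx)).add contDiffAt_const).div_const 2)

theorem angularStep_smul (i : Fin 2) {k : ℝ} (hk : 0 < k) (x : Plane) :
    angularStep i (k • x) = angularStep i x := by
  simp only [angularStep, norm_smul, Real.norm_of_nonneg hk.le, PiLp.smul_apply, smul_eq_mul,
    mul_div_mul_left _ _ hk.ne']

/-- The step is homogeneous of degree 0, so its derivative is homogeneous of degree -1 and is
controlled by its maximum on the unit circle. -/
theorem angularStep_punctureSmooth (i : Fin 2) : ∃ C, PunctureSmooth C (angularStep i) := by
  have hc : ContinuousOn (fderiv ℝ (angularStep i)) (Metric.sphere (0 : Plane) 1) := fun x hx =>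
    ((angularStep_contDiffAt i (ne_zero_of_mem_unit_sphere ⟨x, hx⟩)).fderiv_right
      (m := 0) (by simp)).continuousAt.continuousWithinAt
  obtain ⟨C, hC⟩ := (isCompact_sphere (0 : Plane) 1).exists_bound_of_continuousOn hc
  refine ⟨max 1 C, fun x hx => angularStep_contDiffAt i hx, fun x => ?_, fun x => ?_⟩
  · rw [abs_of_nonneg (angularStep_nonneg i x)]
    exact (angularStep_le_one i x).trans (le_max_left _ _)
  · rcases eq_or_ne x 0 with rfl | hx
    · simp
    have hn : 0 < ‖x‖ := norm_pos_iff.2 hx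
    have he : fderiv ℝ (angularStep i) x = ‖x‖⁻¹ • fderiv ℝ (angularStep i) (‖x‖⁻¹ • x) := by
      rw [← fderiv_comp_smul]
      congr 1
      ext y
      exact (angularStep_smul i (inv_pos.2 hn) y).symm
    rw [he, norm_smul, norm_inv, norm_norm, mul_inv_cancel_left₀ hn.ne']
    refine (hC _ ?_).trans (le_max_right _ _)
    simp [norm_smul, hn.ne']

theorem norm_sq_plane (x : Plane) : ‖x‖ ^ 2 = x 0 ^ 2 + x 1 ^ 2 := by
  rw [EuclideanSpace.real_norm_sq_eq, Fin.sum_univ_two]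

theorem norm_le_sqrt_two_mul (x : Plane) {a : ℝ} (ha : 0 ≤ a) (h : ‖x‖ ^ 2 ≤ 2 * a ^ 2) :
    ‖x‖ ≤ √2 * a := by
  refine abs_le_of_sq_le_sq' ?_ (by positivity) |>.2
  rw [mul_pow, Real.sq_sqrt (by norm_num)]
  exact h

theorem angularStep_eq_one {i : Fin 2} {x : Plane} (hx : x ≠ 0) (h0 : 0 ≤ x i)
    (h : ‖x‖ ^ 2 ≤ 2 * x i ^ 2) : angularStep i x = 1 := by
  refine Real.smoothTransition.one_of_one_le ?_
  have hn : 0 < ‖x‖ := norm_pos_iff.2 hx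
  have : 1 ≤ √2 * (x i / ‖x‖) := by
    rw [mul_div_assoc', le_div_iff₀ hn, one_mul]
    exact norm_le_sqrt_two_mul x h0 h
  linarith

theorem angularStep_eq_zero {i : Fin 2} {x : Plane} (hx : x ≠ 0) (h0 : x i ≤ 0)
    (h : ‖x‖ ^ 2 ≤ 2 * x i ^ 2) : angularStep i x = 0 := by
  refine Real.smoothTransition.zero_of_nonpos ?_
  have hn : 0 < ‖x‖ := norm_pos_iff.2 hx
  have : 1 ≤ √2 * (-x i / ‖x‖) := by
    rw [mul_div_assoc', le_div_iff₀ hn, one_mul]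
    exact norm_le_sqrt_two_mul x (neg_nonneg.2 h0) (by simpa using h)
  rw [neg_div, mul_neg] at this
  linarith

/-- On the closed cones the step attains its global maximum `1` or minimum `0`. Fermat's rule
therefore covers the diagonals too, where the step need not be locally constant. -/
theorem fderiv_angularStep_eq_zero {i : Fin 2} {x : Plane} (hx : x ≠ 0)
    (h : ‖x‖ ^ 2 ≤ 2 * x i ^ 2) : fderiv ℝ (angularStep i) x = 0 := by
  rcases le_total 0 (x i) with h0 | h0
  · refine IsLocalMax.fderiv_eq_zero (.of_forall fun y => ?_)
    rw [angularStep_eq_one hx h0 h]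
    exact angularStep_le_one i y
  · refine IsLocalMin.fderiv_eq_zero (.of_forall fun y => ?_)
    rw [angularStep_eq_zero hx h0 h]
    exact angularStep_nonneg i y

theorem fderiv_angularStep_one_eq_zero {x : Plane} (hx : x ≠ 0) (h : |x 0| ≤ |x 1|) :
    fderiv ℝ (angularStep 1) x = 0 :=
  fderiv_angularStep_eq_zero hx (by rw [norm_sq_plane]; linarith [sq_le_sq.2 h])

theorem fderiv_angularStep_zero_eq_zero {x : Plane} (hx : x ≠ 0) (h : |x 1| ≤ |x 0|) :
    fderiv ℝ (angularStep 0) x = 0 :=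
  fderiv_angularStep_eq_zero hx (by rw [norm_sq_plane]; linarith [sq_le_sq.2 h])

/-! ### Rotated gradients and the pairing density -/

/-- The rotation by a right angle. -/
noncomputable def rot (y : Plane) : Plane := !₂[-y 1, y 0]

theorem norm_rot (y : Plane) : ‖rot y‖ = ‖y‖ := by
  rw [← sq_eq_sq₀ (norm_nonneg _) (norm_nonneg _), norm_sq_plane, norm_sq_plane]
  simp [rot]
  ring

theorem inner_rot (y z : Plane) : inner ℝ (rot y) z = y 0 * z 1 - y 1 * z 0 := by
  simp [rot, PiLp.inner_apply, Fin.sum_univ_two]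
  ring

theorem rot_zero : rot 0 = 0 := by
  rw [← norm_eq_zero, norm_rot, norm_zero]

theorem continuous_rot : Continuous rot := by
  unfold rot
  fun_prop

theorem gradient_apply (f : Plane → ℝ) (x : Plane) (i : Fin 2) :
    gradient f x i = fderiv ℝ f x (EuclideanSpace.single i 1) := by
  rw [← inner_gradient, EuclideanSpace.inner_single_left]
  simp

theorem inner_rot_gradient (f g : Plane → ℝ) (x : Plane) :
    inner ℝ (rot (gradient f x)) (gradient g x) =
      fderiv ℝ f x (EuclideanSpace.single 0 1) * fderiv ℝ g x (EuclideanSpace.single 1 1) -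
      fderiv ℝ f x (EuclideanSpace.single 1 1) * fderiv ℝ g x (EuclideanSpace.single 0 1) := by
  simp only [inner_rot, gradient_apply]

/-- Symmetry of second derivatives gives ∂₀f ∂₁η − ∂₁f ∂₀η = ∂₀(f ∂₁η) − ∂₁(f ∂₀η) away from the
origin. Both terms on the right are derivatives of compactly supported punctured-smooth functions.
-/
theorem PunctureSmooth.integral_inner_rot_gradient {C : ℝ} {f : Plane → ℝ}
    (hf : PunctureSmooth C f) {η : Plane → ℝ} (hη : ContDiff ℝ ∞ η) (hc : HasCompactSupport η) :
    ∫ x, inner ℝ (rot (gradient f x)) (gradient η x) = 0 := by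
  have hpart : ∀ v : Plane, ContDiff ℝ ∞ (fun x => fderiv ℝ η x v) := fun v =>
    (hη.fderiv_right (by simp)).clm_apply contDiff_const
  have hpc : ∀ v : Plane, HasCompactSupport (fun x => fderiv ℝ η x v) := fun v =>
    hc.fderiv_apply ℝ v
  have hF : ∀ v : Plane, ∃ D, PunctureSmooth D (fun x => f x * fderiv ℝ η x v) := fun v => by
    obtain ⟨D, hD⟩ := punctureSmooth_of_contDiff (hpart v) (hpc v)
    exact ⟨_, hf.mul hD⟩
  have hz : ∀ v e : Plane, ∫ x, fderiv ℝ (fun x => f x * fderiv ℝ η x v) x e = 0 := fun v e => by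
    obtain ⟨D, hD⟩ := hF v
    exact hD.integral_fderiv_eq_zero (hpc v).mul_left e
  have hi : ∀ v e : Plane, Integrable fun x => fderiv ℝ (fun x => f x * fderiv ℝ η x v) x e :=
    fun v e => by
      obtain ⟨D, hD⟩ := hF v
      simpa only [inner_gradient] using
        (hD.integrable_gradient (hpc v).mul_left).const_inner (𝕜 := ℝ) e
  set e₀ : Plane := EuclideanSpace.single 0 1
  set e₁ : Plane := EuclideanSpace.single 1 1
  have hdiff := integral_sub (hi e₁ e₀) (hi e₀ e₁)
  rw [hz, hz, sub_zero] at hdiff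
  rw [← hdiff]
  refine integral_congr_ae ?_
  filter_upwards [Measure.ae_ne volume (0 : Plane)] with x hx
  have hd : DifferentiableAt ℝ (fderiv ℝ η) x :=
    (hη.fderiv_right (m := ∞) (by simp)).differentiable (by simp) x
  have hsnd : ∀ v e : Plane,
      fderiv ℝ (fun x => fderiv ℝ η x v) x e = fderiv ℝ (fderiv ℝ η) x e v := fun v e => by
    rw [fderiv_clm_apply hd (differentiableAt_const v)]
    simp
  have hsymm : fderiv ℝ (fderiv ℝ η) x e₀ e₁ = fderiv ℝ (fderiv ℝ η) x e₁ e₀ :=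
    (hη.contDiffAt.isSymmSndFDerivAt (by
      rw [minSmoothness_of_isRCLikeNormedField]
      exact WithTop.coe_le_coe.2 (le_top : (2 : ℕ∞) ≤ ⊤))).eq e₀ e₁
  rw [inner_rot_gradient,
    fderiv_fun_mul (hf.differentiableAt hx) ((hpart e₁).differentiable (by simp) x),
    fderiv_fun_mul (hf.differentiableAt hx) ((hpart e₀).differentiable (by simp) x)]
  simp only [add_apply, smul_apply, smul_eq_mul, hsnd,
    hsymm]
  ring

theorem fderiv_norm_eq_zero {x y : Plane} (hx : x ≠ 0) (h : inner ℝ x y = 0) :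
    fderiv ℝ (fun z : Plane => ‖z‖) x y = 0 := by
  have hd : DifferentiableAt ℝ (fun z : Plane => ‖z‖) x :=
    (contDiffAt_norm ℝ (n := 1) hx).differentiableAt (by simp)
  have h1 : HasFDerivAt (fun z : Plane => ‖z‖ * ‖z‖)
      (‖x‖ • fderiv ℝ (fun z : Plane => ‖z‖) x + ‖x‖ • fderiv ℝ (fun z : Plane => ‖z‖) x) x :=
    hd.hasFDerivAt.mul hd.hasFDerivAt
  have h2 : HasFDerivAt (fun z : Plane => ‖z‖ * ‖z‖) (2 • innerSL ℝ x) x := by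
    simpa only [sq] using (hasStrictFDerivAt_norm_sq x).hasFDerivAt
  have h3 := congrArg (fun A : Plane →L[ℝ] ℝ => A y) (h1.unique h2)
  simp [h] at h3
  exact h3.resolve_left hx

theorem fderiv_angularStep_tangent {x : Plane} (hx : x ≠ 0) :
    fderiv ℝ (angularStep 0) x (!₂[x 1, -x 0] : Plane) =
      deriv Real.smoothTransition ((√2 * (x 0 / ‖x‖) + 1) / 2) * (√2 / 2 * (x 1 / ‖x‖)) := by
  set τ : Plane := !₂[x 1, -x 0] with hτ
  have hn : ‖x‖ ≠ 0 := norm_ne_zero_iff.2 hx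
  have hperp : inner ℝ x τ = 0 := by
    simp [hτ, PiLp.inner_apply, Fin.sum_univ_two]
    ring
  have hdn : DifferentiableAt ℝ (fun z : Plane => ‖z‖) x :=
    (contDiffAt_norm ℝ (n := 1) hx).differentiableAt (by simp)
  have hda : DifferentiableAt ℝ (fun y : Plane => y 0 / ‖y‖) x :=
    (contDiffAt_angle 0 hx).differentiableAt (by simp)
  have hang : fderiv ℝ (fun y : Plane => y 0 / ‖y‖) x τ = x 1 / ‖x‖ := by
    have h1 := hda.hasFDerivAt.mul hdn.hasFDerivAt
    have h2 : HasFDerivAt (fun y : Plane => y 0) (EuclideanSpace.proj (𝕜 := ℝ) (0 : Fin 2)) x :=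
      (EuclideanSpace.proj (𝕜 := ℝ) (0 : Fin 2)).hasFDerivAt
    -- Differentiating y₀ = (y₀ / |y|) |y| replaces the quotient rule. The tangent direction kills
    -- the derivative of the norm.
    have h3 := h1.congr_of_eventuallyEq (f₁ := fun y : Plane => y 0) (by
      filter_upwards [isOpen_ne.mem_nhds hx] with y hy
      exact (div_mul_cancel₀ _ (norm_ne_zero_iff.2 hy)).symm)
    have h4 := congrArg (fun A : Plane →L[ℝ] ℝ => A τ) (h3.unique h2)
    simp only [add_apply, smul_apply, smul_eq_mul,
      fderiv_norm_eq_zero hx hperp, mul_zero, zero_add] at h4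
    rw [eq_div_iff hn, mul_comm, h4]
    simp [hτ]
  have hs : DifferentiableAt ℝ Real.smoothTransition ((√2 * (x 0 / ‖x‖) + 1) / 2) :=
    (Real.smoothTransition.contDiff (n := 1)).differentiable (by simp) _
  have h5 : HasFDerivAt (fun y : Plane => (√2 * (y 0 / ‖y‖) + 1) / 2)
      ((√2 / 2) • fderiv ℝ (fun y : Plane => y 0 / ‖y‖) x) x := by
    have := ((hda.hasFDerivAt.const_mul √2).add_const 1).mul_const (2⁻¹ : ℝ)
    convert! this using 1
    rw [smul_smul]
    congr 1
    ring
  have h6 : HasFDerivAt (angularStep 0) _ x := hs.hasDerivAt.comp_hasFDerivAt x h5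
  rw [h6.fderiv]
  simp [hang]

theorem gradient_cutoff (a : ℝ) (x : Plane) :
    gradient (cutoff a) x = (-8 * deriv Real.smoothTransition (a - 4 * ‖x‖ ^ 2)) • x := by
  have hs : DifferentiableAt ℝ Real.smoothTransition (a - 4 * ‖x‖ ^ 2) :=
    (Real.smoothTransition.contDiff (n := 1)).differentiable (by simp) _
  have h1 : HasFDerivAt (fun y : Plane => a - 4 * ‖y‖ ^ 2) _ x :=
    ((hasStrictFDerivAt_norm_sq x).hasFDerivAt.const_mul 4).const_sub a
  have h2 : HasFDerivAt (cutoff a) _ x := hs.hasDerivAt.comp_hasFDerivAt x h1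
  refine ext_inner_left ℝ fun v => ?_
  rw [inner_gradient, h2.fderiv]
  simp [inner_smul_right, real_inner_comm]
  ring

/-- The unnormalized competitor. -/
noncomputable def competitor (x : Plane) : ℝ := cutoff 2 x * angularStep 1 x

theorem competitor_punctureSmooth : ∃ C, PunctureSmooth C competitor := by
  obtain ⟨A, hA⟩ := punctureSmooth_of_contDiff (cutoff_contDiff 2) (cutoff_hasCompactSupport 2)
  obtain ⟨B, hB⟩ := angularStep_punctureSmooth 1
  exact ⟨_, hA.mul hB⟩

theorem gradient_competitor {x : Plane} (hx : x ≠ 0) :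
    gradient competitor x =
      cutoff 2 x • gradient (angularStep 1) x + angularStep 1 x • gradient (cutoff 2) x := by
  have h : fderiv ℝ competitor x = _ :=
    fderiv_fun_mul ((cutoff_contDiff 2).differentiable (by simp) x)
      ((angularStep_contDiffAt 1 hx).differentiableAt (by simp))
  rw [gradient, h, map_add, map_smul, map_smul]
  rfl

/-- At each point one of the two angular gradients vanishes, so only the gradient of the cutoff
survives. It is radial, and pairing it with a rotated gradient gives a tangential derivative. -/
theorem inner_rot_gradient_competitor {x : Plane} (hx : x ≠ 0) :
    inner ℝ (rot (gradient (angularStep 0) x)) (gradient competitor x) =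
      angularStep 1 x * (-8 * deriv Real.smoothTransition (2 - 4 * ‖x‖ ^ 2)) *
        (deriv Real.smoothTransition ((√2 * (x 0 / ‖x‖) + 1) / 2) * (√2 / 2 * (x 1 / ‖x‖))) := by
  have hcross : inner ℝ (rot (gradient (angularStep 0) x)) (gradient (angularStep 1) x) = 0 := by
    rcases le_total |x 0| |x 1| with h | h
    · simp [gradient, fderiv_angularStep_one_eq_zero hx h]
    · simp [gradient, fderiv_angularStep_zero_eq_zero hx h, rot_zero]
  have htan : inner ℝ (rot (gradient (angularStep 0) x)) x =
      fderiv ℝ (angularStep 0) x (!₂[x 1, -x 0] : Plane) := by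
    rw [← inner_gradient, inner_rot, PiLp.inner_apply, Fin.sum_univ_two]
    simp
    ring
  rw [gradient_competitor hx, inner_add_right, inner_smul_right, hcross, inner_smul_right,
    gradient_cutoff, inner_smul_right, htan, fderiv_angularStep_tangent hx]
  ring

/-- In the upper half-plane every factor has a known sign. In the lower one the pairing is zero: the
competitor's step vanishes in the lower cone and the field in the side cones. -/
theorem inner_rot_gradient_competitor_nonpos {x : Plane} (hx : x ≠ 0) :
    inner ℝ (rot (gradient (angularStep 0) x)) (gradient competitor x) ≤ 0 := by
  have hs : ∀ t, 0 ≤ deriv Real.smoothTransition t := fun t =>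
    Real.smoothTransition.monotone.deriv_nonneg
  rcases le_total 0 (x 1) with h | h
  · rw [inner_rot_gradient_competitor hx]
    have h1 := angularStep_nonneg 1 x
    have h2 : 0 ≤ deriv Real.smoothTransition ((√2 * (x 0 / ‖x‖) + 1) / 2) *
      (√2 / 2 * (x 1 / ‖x‖)) := mul_nonneg (hs _) (by positivity)
    have h3 := hs (2 - 4 * ‖x‖ ^ 2)
    refine mul_nonpos_of_nonpos_of_nonneg (mul_nonpos_of_nonneg_of_nonpos h1 (by linarith)) h2
  · rcases le_total |x 0| |x 1| with h' | h'
    · rw [inner_rot_gradient_competitor hx, angularStep_eq_zero hx h]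
      · simp
      · rw [norm_sq_plane]; linarith [sq_le_sq.2 h']
    · simp [gradient, fderiv_angularStep_zero_eq_zero hx h', rot_zero]

/-! ### The pairing integrated over the square -/

theorem isOpen_square : IsOpen square := by
  have : square = ⋂ i : Fin 2, {x : Plane | x i ∈ Ioo (-1 : ℝ) 1} := by
    ext x; simp [square]
  rw [this]
  exact isOpen_iInter_of_finite fun i => isOpen_Ioo.preimage (by fun_prop)

theorem mem_square_of_norm_lt {x : Plane} (hx : ‖x‖ < 1) : x ∈ square := fun i =>
  abs_lt.1 (lt_of_le_of_lt (PiLp.norm_apply_le x i) hx)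

theorem square_subset_ball : square ⊆ Metric.ball 0 2 := by
  intro x hx
  have h0 := abs_lt.2 (hx 0)
  have h1 := abs_lt.2 (hx 1)
  have : ‖x‖ ^ 2 < 2 := by
    rw [norm_sq_plane, ← sq_abs (x 0), ← sq_abs (x 1)]
    nlinarith [abs_nonneg (x 0), abs_nonneg (x 1)]
  rw [mem_ball_zero_iff]
  nlinarith [norm_nonneg x]

theorem exists_inner_rot_gradient_competitor_ne_zero :
    ∃ x ∈ square, x ≠ 0 ∧
      inner ℝ (rot (gradient (angularStep 0) x)) (gradient competitor x) ≠ 0 := by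
  -- The mean value theorem gives a `t` where the smooth transition has slope `1`. The radius `r`
  -- and the cosine `c` are chosen so that both the radial and the angular argument equal `t`, and
  -- `c ^ 2 ≤ 1 / 2` places the point in the upper cone.
  obtain ⟨t, ⟨ht0, ht1⟩, ht⟩ := exists_deriv_eq_slope Real.smoothTransition zero_lt_one
    Real.smoothTransition.continuous.continuousOn
    ((Real.smoothTransition.contDiff (n := 1)).differentiable (by simp)).differentiableOn
  rw [Real.smoothTransition.one, Real.smoothTransition.zero] at ht
  set r : ℝ := √(2 - t) / 2 with hr
  have hr2 : r ^ 2 = (2 - t) / 4 := by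
    rw [hr, div_pow, Real.sq_sqrt (by linarith)]; norm_num
  have hrpos : 0 < r := by rw [hr]; have := Real.sqrt_pos.2 (show 0 < 2 - t by linarith); linarith
  set c : ℝ := (2 * t - 1) / √2 with hc
  have hc2 : c ^ 2 = (2 * t - 1) ^ 2 / 2 := by rw [hc, div_pow, Real.sq_sqrt (by norm_num)]
  have hc2' : c ^ 2 ≤ 1 / 2 := by rw [hc2]; nlinarith
  set s : ℝ := √(1 - c ^ 2) with hs
  have hs2 : s ^ 2 = 1 - c ^ 2 := by rw [hs, Real.sq_sqrt (by linarith)]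
  have hspos : 0 < s := Real.sqrt_pos.2 (by linarith)
  set x : Plane := !₂[r * c, r * s] with hx
  have hx0 : x 0 = r * c := by simp [hx]
  have hx1 : x 1 = r * s := by simp [hx]
  have hnsq : ‖x‖ ^ 2 = r ^ 2 := by
    rw [norm_sq_plane, hx0, hx1]; linear_combination r ^ 2 * hs2
  have hn : ‖x‖ = r := by
    rwa [sq_eq_sq₀ (norm_nonneg _) hrpos.le] at hnsq
  have hxne : x ≠ 0 := norm_pos_iff.1 (hn ▸ hrpos)
  refine ⟨x, mem_square_of_norm_lt (by rw [hn]; nlinarith), hxne, ?_⟩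
  have hone : angularStep 1 x = 1 := by
    refine angularStep_eq_one hxne (by rw [hx1]; positivity) ?_
    rw [hnsq, hx1, mul_pow, hs2]
    nlinarith [sq_nonneg r]
  have harg : (√2 * (x 0 / ‖x‖) + 1) / 2 = t := by
    rw [hx0, hn, mul_div_cancel_left₀ _ hrpos.ne', hc, mul_div_cancel₀ _ (by positivity)]
    ring
  have harg' : 2 - 4 * ‖x‖ ^ 2 = t := by rw [hnsq, hr2]; ring
  rw [inner_rot_gradient_competitor hxne, hone, harg, harg', ht, hx1, hn,
    mul_div_cancel_left₀ _ hrpos.ne']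
  have : 0 < √2 * s := by positivity
  intro h
  linarith

theorem PunctureSmooth.continuousOn_gradient {C : ℝ} {f : Plane → ℝ} (hf : PunctureSmooth C f) :
    ContinuousOn (gradient f) {0}ᶜ := fun x hx =>
  ((InnerProductSpace.toDual ℝ Plane).symm.continuous.continuousAt.comp
    ((hf.smooth x hx).fderiv_right (m := 0) (by simp)).continuousAt).continuousWithinAt

theorem gradient_cutoff_bounded (a : ℝ) : ∃ K, ∀ x, ‖gradient (cutoff a) x‖ ≤ K := by
  obtain ⟨K, hK⟩ := ((cutoff_hasCompactSupport a).fderiv ℝ).exists_bound_of_continuous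
    ((cutoff_contDiff a).continuous_fderiv (by simp))
  exact ⟨K, fun x => (norm_gradient _ x).trans_le (hK x)⟩

/-- In the upper and lower cones the angular factor has zero gradient, so only the bounded gradient
of the cutoff remains. -/
theorem norm_gradient_competitor_le : ∃ K, ∀ x : Plane, |x 0| < |x 1| →
    ‖gradient competitor x‖ ≤ K := by
  obtain ⟨K, hK⟩ := gradient_cutoff_bounded 2
  refine ⟨K, fun x h => ?_⟩
  have hx : x ≠ 0 := by rintro rfl; simp at h
  rw [gradient_competitor hx, gradient, fderiv_angularStep_one_eq_zero hx h.le, map_zero,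
    smul_zero, zero_add, norm_smul, Real.norm_of_nonneg (angularStep_nonneg 1 x)]
  exact (mul_le_of_le_one_left (norm_nonneg _) (angularStep_le_one 1 x)).trans (hK x)

theorem PunctureSmooth.integrableOn_gradient_square {C : ℝ} {f : Plane → ℝ}
    (hf : PunctureSmooth C f) : IntegrableOn (gradient f) square :=
  (hf.locallyIntegrable_gradient.integrableOn_isCompact
    (isCompact_closedBall (0 : Plane) 2)).mono_set
      (square_subset_ball.trans Metric.ball_subset_closedBall)

theorem integral_inner_rot_gradient_competitor_neg :
    ∫ x in square, inner ℝ (rot (gradient (angularStep 0) x)) (gradient competitor x) < 0 := by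
  obtain ⟨A, hA⟩ := angularStep_punctureSmooth 0
  obtain ⟨B, hB⟩ := competitor_punctureSmooth
  obtain ⟨K, hK⟩ := norm_gradient_competitor_le
  -- Each factor alone may be of order `1 / |x|`, but where the field is nonzero the competitor's
  -- gradient is bounded.
  have hinteg : IntegrableOn
      (fun x => inner ℝ (rot (gradient (angularStep 0) x)) (gradient competitor x)) square := by
    refine Integrable.mono' (hA.integrableOn_gradient_square.norm.mul_const K) ?_ ?_
    · exact ((continuous_rot.measurable.comp (measurable_gradient _)).inner
        (measurable_gradient _)).aestronglyMeasurable
    · filter_upwards [ae_restrict_of_ae (Measure.ae_ne volume (0 : Plane))] with x hx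
      rcases lt_or_ge |x 0| |x 1| with h | h
      · refine (norm_inner_le_norm _ _).trans ?_
        rw [norm_rot]
        exact mul_le_mul_of_nonneg_left (hK x h) (norm_nonneg _)
      · simp [gradient, fderiv_angularStep_zero_eq_zero hx h, rot_zero]
  have hae : ∀ᵐ x ∂volume.restrict square,
      0 ≤ -inner ℝ (rot (gradient (angularStep 0) x)) (gradient competitor x) := by
    filter_upwards [ae_restrict_of_ae (Measure.ae_ne volume (0 : Plane))] with x hx
    exact neg_nonneg.2 (inner_rot_gradient_competitor_nonpos hx)
  have hle := integral_nonneg_of_ae hae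
  rw [integral_neg] at hle
  refine lt_of_le_of_ne (by linarith) fun h0 => ?_
  have h1 : ∫ x in square,
      -inner ℝ (rot (gradient (angularStep 0) x)) (gradient competitor x) = 0 := by
    rw [integral_neg, h0, neg_zero]
  rw [integral_eq_zero_iff_of_nonneg_ae hae hinteg.neg] at h1
  obtain ⟨x, hxs, hx0, hne⟩ := exists_inner_rot_gradient_competitor_ne_zero
  -- A zero integral would make the signed integrand vanish almost everywhere, hence everywhere on
  -- the punctured square by continuity.
  have h2 := Measure.eqOn_open_of_ae_eq
    (ae_restrict_of_ae_restrict_of_subset (inter_subset_left (t := ({0}ᶜ : Set Plane))) h1)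
    (isOpen_square.inter isOpen_compl_singleton) ?_ continuousOn_const
  · exact hne (neg_eq_zero.1 (h2 ⟨hxs, hx0⟩))
  · exact ((continuous_rot.comp_continuousOn hA.continuousOn_gradient).inner
      hB.continuousOn_gradient).neg.mono inter_subset_right

/-- The competitor `w` and the solenoidal field `b`, whose supports interact only through the
cutoff. -/
theorem exists_competitor_field : ∃ (w : Plane → ℝ) (b : Plane → Plane),
    (∃ C, PunctureSmooth C w) ∧ tsupport w ⊆ {x | 4 * ‖x‖ ^ 2 ≤ 2} ∧
    (∀ x, ‖x‖ * ‖gradient w x‖ ≤ 1) ∧ (∃ K : ℝ≥0, ∀ x, |x 0| < |x 1| → ‖gradient w x‖₊ ≤ K) ∧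
    Measurable b ∧ IntegrableOn b square ∧ (∀ x, ‖x‖ * ‖b x‖ ≤ 1) ∧
    (∀ x, x ≠ 0 → |x 1| ≤ |x 0| → b x = 0) ∧
    (∀ η ∈ testFunctions square, ∫ x in square, inner ℝ (b x) (gradient η x) = 0) ∧
    ∫ x in square, inner ℝ (b x) (gradient w x) < 0 := by
  obtain ⟨A, hA⟩ := angularStep_punctureSmooth 0
  obtain ⟨B, hB⟩ := competitor_punctureSmooth
  obtain ⟨K, hK⟩ := norm_gradient_competitor_le
  have hA0 := hA.nonneg
  have hB0 := hB.nonneg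
  -- Normalizing both gradient bounds to `1 / |x|` lets the two integrability hypotheses be applied
  -- verbatim. The `+ 1` keeps the denominators positive.
  set α : ℝ := (A + 1)⁻¹ with hα
  set β : ℝ := (B + 1)⁻¹ with hβ
  have hαpos : 0 < α := inv_pos.2 (by linarith)
  have hβpos : 0 < β := inv_pos.2 (by linarith)
  have hw : PunctureSmooth (|β| * B) (fun x => β * competitor x) := hB.const_mul β
  have hgw : ∀ x, gradient (fun x => β * competitor x) x = β • gradient competitor x := by
    intro x
    have h : fderiv ℝ (fun x => β * competitor x) x = β • fderiv ℝ competitor x := by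
      exact congrFun (fderiv_const_smul_field (𝕜 := ℝ) (f := competitor) β) x
    rw [gradient, h, map_smul]
    rfl
  have hmeas : Measurable fun x => rot (gradient (angularStep 0) x) :=
    continuous_rot.measurable.comp (measurable_gradient _)
  have hinteg : IntegrableOn (fun x => rot (gradient (angularStep 0) x)) square :=
    Integrable.mono hA.integrableOn_gradient_square hmeas.aestronglyMeasurable
      (.of_forall fun x => (norm_rot _).le)
  refine ⟨fun x => β * competitor x, fun x => α • rot (gradient (angularStep 0) x),
    ⟨_, hw⟩, ?_, fun x => ?_, ⟨(β * |K|).toNNReal, fun x h => ?_⟩, hmeas.const_smul α, ?_,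
    fun x => ?_, fun x hx h => ?_, fun η hη => ?_, ?_⟩
  · refine (closure_mono ?_).trans (tsupport_cutoff (a := 2))
    intro x hx h0
    exact hx (by simp [competitor, h0])
  · rw [norm_gradient]
    refine (hw.fderiv_bound x).trans ?_
    rw [abs_of_pos hβpos, hβ, inv_mul_le_iff₀ (by linarith)]
    linarith
  · rw [← NNReal.coe_le_coe, Real.coe_toNNReal _ (by positivity), coe_nnnorm, hgw, norm_smul,
      Real.norm_of_nonneg hβpos.le]
    exact mul_le_mul_of_nonneg_left ((hK x h).trans (le_abs_self K)) hβpos.le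
  · exact hinteg.smul α
  · rw [norm_smul, norm_rot, Real.norm_of_nonneg hαpos.le, mul_left_comm, norm_gradient, hα,
      inv_mul_le_iff₀ (by linarith)]
    linarith [hA.fderiv_bound x]
  · simp [gradient, fderiv_angularStep_zero_eq_zero hx h, rot_zero]
  · simp only [inner_smul_left]
    rw [integral_const_mul, setIntegral_eq_integral_of_forall_compl_eq_zero,
      hA.integral_inner_rot_gradient hη.1 hη.2.1, mul_zero]
    intro x hx
    have : fderiv ℝ η x = 0 := by
      by_contra h
      exact hx (hη.2.2 (support_fderiv_subset ℝ h))
    simp [gradient, this]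
  · simp only [hgw, inner_smul_left, inner_smul_right]
    rw [integral_const_mul, integral_const_mul]
    exact mul_neg_of_pos_of_neg hβpos
      (mul_neg_of_pos_of_neg (by simpa using hαpos) integral_inner_rot_gradient_competitor_neg)

/-! ### Orlicz functions -/

theorem IsOrlicz.map_mul_le {θ : ℝ≥0 → ℝ≥0∞} (h : IsOrlicz θ) {l : ℝ≥0} (hl : l ≤ 1) (t : ℝ≥0) :
    θ (l * t) ≤ l * θ t := by
  have := h.convex.2 (mem_univ t) (mem_univ 0) (zero_le (a := l)) (zero_le (a := 1 - l))
    (add_tsub_cancel_of_le hl)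
  simpa [h.map_zero, ENNReal.smul_def] using this

theorem IsOrlicz.monotone {θ : ℝ≥0 → ℝ≥0∞} (h : IsOrlicz θ) : Monotone θ := by
  intro s t hst
  rcases eq_or_ne t 0 with rfl | ht
  · rw [nonpos_iff_eq_zero.1 hst]
  have hl : s / t ≤ 1 := div_le_one_of_le₀ hst zero_le
  have := h.map_mul_le hl t
  rw [div_mul_cancel₀ _ ht] at this
  refine this.trans (mul_le_of_le_one_left zero_le ?_)
  exact_mod_cast hl

theorem conj_monotone (θ : ℝ≥0 → ℝ≥0∞) : Monotone (conj θ) := by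
  intro s t hst
  refine iSup_mono fun r => tsub_le_tsub_right ?_ _
  exact_mod_cast mul_le_mul_left hst r

theorem conj_zero (θ : ℝ≥0 → ℝ≥0∞) : conj θ 0 = 0 := by simp [conj]

theorem conj_anti {θ ρ : ℝ≥0 → ℝ≥0∞} (h : ∀ t, θ t ≤ ρ t) (s : ℝ≥0) : conj ρ s ≤ conj θ s :=
  iSup_mono fun t => tsub_le_tsub_left (h t) _

/-- Each competitor in the supremum satisfies l s t − θ t ≤ l (s t − θ t), since l ≤ 1. No property
of `θ` enters. -/
theorem conj_mul_le (θ : ℝ≥0 → ℝ≥0∞) {l : ℝ≥0} (hl : l ≤ 1) (s : ℝ≥0) :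
    conj θ (l * s) ≤ l * conj θ s := by
  refine iSup_le fun t => ?_
  refine le_trans ?_ (mul_le_mul_right (le_iSup (fun t : ℝ≥0 => ((s * t : ℝ≥0) : ℝ≥0∞) - θ t) t) _)
  rw [ENNReal.mul_sub (fun _ _ => ENNReal.coe_ne_top), mul_assoc, ENNReal.coe_mul]
  refine tsub_le_tsub_left (mul_le_of_le_one_left zero_le ?_) _
  exact_mod_cast hl

theorem mul_le_add_conj (θ : ℝ≥0 → ℝ≥0∞) (s t : ℝ≥0) :
    ((s * t : ℝ≥0) : ℝ≥0∞) ≤ conj θ s + θ t :=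
  tsub_le_iff_right.1 (le_iSup (fun t : ℝ≥0 => ((s * t : ℝ≥0) : ℝ≥0∞) - θ t) t)

/-- A monotone function that is infinite at `t` is infinite at 1/r for all small r, so the integral
would diverge. Finiteness is what later allows passing to real-valued functions in polar
coordinates. -/
theorem ne_top_of_finiteNearZero {θ : ℝ≥0 → ℝ≥0∞} (hm : Monotone θ) (h : FiniteNearZero θ)
    (t : ℝ≥0) : θ t ≠ ⊤ := by
  obtain ⟨δ, hδ, hlt⟩ := h
  intro htop
  set ρ : ℝ := min δ (1 / (t + 1)) with hρ
  have hρpos : 0 < ρ := lt_min hδ (by positivity)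
  have hall : ∀ r ∈ Ioo (0 : ℝ) ρ, θ (Real.toNNReal (1 / r)) * ENNReal.ofReal r = ⊤ := by
    intro r hr
    have h1 : t ≤ Real.toNNReal (1 / r) := by
      rw [← NNReal.coe_le_coe, Real.coe_toNNReal _ (one_div_nonneg.2 hr.1.le),
        le_div_iff₀ hr.1]
      have : r ≤ 1 / ((t : ℝ) + 1) := hr.2.le.trans (min_le_right _ _)
      rw [le_div_iff₀ (by positivity)] at this
      nlinarith [hr.1, t.coe_nonneg]
    rw [top_le_iff.1 (htop.symm.le.trans (hm h1))]
    exact ENNReal.top_mul (ENNReal.ofReal_pos.2 hr.1).ne'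
  refine hlt.ne (top_le_iff.1 ?_)
  calc ⊤ = ∫⁻ r in Ioo (0 : ℝ) ρ, (⊤ : ℝ≥0∞) := by
        rw [setLIntegral_const, Real.volume_Ioo, ENNReal.top_mul]
        simpa using hρpos
    _ = ∫⁻ r in Ioo (0 : ℝ) ρ, θ (Real.toNNReal (1 / r)) * ENNReal.ofReal r :=
        setLIntegral_congr_fun measurableSet_Ioo fun r hr => (hall r hr).symm
    _ ≤ _ := lintegral_mono_set (Ioo_subset_Ioo_right (min_le_left _ _))

/-- Near the origin, polar coordinates produce the weight `r dr` of `FiniteNearZero`. Away from it,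
monotonicity bounds the integrand. -/
theorem lintegral_square_lt_top {θ : ℝ≥0 → ℝ≥0∞} (hm : Monotone θ) (h : FiniteNearZero θ) :
    ∫⁻ x in square, θ (‖x‖₊⁻¹) < ⊤ := by
  have hfin := ne_top_of_finiteNearZero hm h
  obtain ⟨δ, hδ, hlt⟩ := h
  have hmeas : Measurable fun r : ℝ => θ (Real.toNNReal (1 / r)) :=
    hm.measurable.comp (by fun_prop)
  have hball : ∫⁻ x in Metric.ball (0 : Plane) δ, θ (‖x‖₊⁻¹) < ⊤ := by
    have h1 : IntegrableOn (fun r : ℝ => (θ (Real.toNNReal (1 / r)) * ENNReal.ofReal r).toReal)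
        (Ioo 0 δ) :=
      integrable_toReal_of_lintegral_ne_top
        (hmeas.mul ENNReal.measurable_ofReal).aemeasurable hlt.ne
    have h2 : IntegrableOn (fun x : Plane => (θ (Real.toNNReal (1 / ‖x‖))).toReal)
        (Metric.ball 0 δ) := by
      rw [integrableOn_fun_norm_addHaar volume
        (f := fun r : ℝ => (θ (Real.toNNReal (1 / r))).toReal)]
      refine h1.congr_fun (fun r hr => ?_) measurableSet_Ioo
      simp [ENNReal.toReal_mul, ENNReal.toReal_ofReal hr.1.le, mul_comm]
    refine lt_of_le_of_lt (le_of_eq ?_) h2.lintegral_lt_top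
    refine lintegral_congr fun x => ?_
    rw [ENNReal.ofReal_toReal (hfin _), one_div, Real.toNNReal_inv, norm_toNNReal]
  have hrest : ∫⁻ x in square \ Metric.ball (0 : Plane) δ, θ (‖x‖₊⁻¹) < ⊤ := by
    refine setLIntegral_lt_top_of_le_nnreal
      (measure_ne_top_of_subset (sdiff_subset.trans square_subset_ball) measure_ball_lt_top.ne)
      ⟨(θ (Real.toNNReal δ)⁻¹).toNNReal, fun x hx => ?_⟩
    rw [ENNReal.coe_toNNReal (hfin _)]
    have hxδ : δ ≤ ‖x‖ := by simpa using hx.2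
    refine hm (inv_anti₀ (Real.toNNReal_pos.2 hδ) ?_)
    rw [← norm_toNNReal]
    exact Real.toNNReal_le_toNNReal hxδ
  calc ∫⁻ x in square, θ (‖x‖₊⁻¹)
      ≤ ∫⁻ x in Metric.ball (0 : Plane) δ ∪ (square \ Metric.ball (0 : Plane) δ), θ (‖x‖₊⁻¹) :=
        lintegral_mono_set (by rw [union_sdiff_self]; exact subset_union_right)
    _ ≤ _ := lintegral_union_le _ _ _
    _ < ⊤ := ENNReal.add_lt_top.2 ⟨hball, hrest⟩

/-! ### Luxemburg norms -/

/-- Enlarging the scale by a factor m ≥ 1 divides the modular by at least m, so m = 1 + (modular)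
brings it below `1`. -/
theorem luxNorm_lt_top {Φ : Plane → ℝ≥0 → ℝ≥0∞} {Ω : Set Plane} {f : Plane → Plane}
    (hΦ : ∀ x (l : ℝ≥0), l ≤ 1 → ∀ t, Φ x (l * t) ≤ l * Φ x t) {k : ℝ≥0} (hk : 0 < k)
    (h : ∫⁻ x in Ω, Φ x (‖f x‖₊ / k) < ⊤) : luxNorm Φ Ω f < ⊤ := by
  set I := ∫⁻ x in Ω, Φ x (‖f x‖₊ / k)
  set m : ℝ≥0 := I.toNNReal + 1 with hm
  have hm1 : 1 ≤ m := by rw [hm]; exact le_add_self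
  have hmpos : 0 < m := zero_lt_one.trans_le hm1
  refine lt_of_le_of_lt (sInf_le ⟨m * k, mul_pos hmpos hk, rfl, ?_⟩)
    (ENNReal.coe_lt_top (r := m * k))
  calc ∫⁻ x in Ω, Φ x (‖f x‖₊ / (m * k)) ≤ ∫⁻ x in Ω, (m⁻¹ : ℝ≥0) * Φ x (‖f x‖₊ / k) := by
        refine lintegral_mono fun x => ?_
        have := hΦ x m⁻¹ (inv_le_one_of_one_le₀ hm1) (‖f x‖₊ / k)
        rwa [inv_mul_eq_div, div_div, mul_comm k] at this
    _ = (m⁻¹ : ℝ≥0) * I := lintegral_const_mul' _ _ ENNReal.coe_ne_top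
    _ ≤ (m⁻¹ : ℝ≥0) * m := by
        gcongr
        rw [← ENNReal.coe_toNNReal h.ne]
        exact_mod_cast le_self_add
    _ = 1 := by rw [← ENNReal.coe_mul, inv_mul_cancel₀ hmpos.ne', ENNReal.coe_one]

theorem luxNorm_congr_ae {Φ : Plane → ℝ≥0 → ℝ≥0∞} {Ω : Set Plane} {f g : Plane → Plane}
    (h : f =ᵐ[volume.restrict Ω] g) : luxNorm Φ Ω f = luxNorm Φ Ω g := by
  unfold luxNorm
  congr 1
  ext γ
  refine exists_congr fun c => and_congr_right fun _ => and_congr_right fun _ => ?_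
  rw [lintegral_congr_ae]
  filter_upwards [h] with x hx
  rw [hx]

/-- Hölder's inequality, in the form needed for continuity of linear functionals. -/
theorem lintegral_mul_le_of_luxNorm_lt {Φ : Plane → ℝ≥0 → ℝ≥0∞} {Ω : Set Plane}
    {b f : Plane → Plane} (hb : AEMeasurable (fun x => conjAt Φ x ‖b x‖₊) (volume.restrict Ω))
    {ε : ℝ≥0∞} (h : luxNorm Φ Ω f < ε) :
    ∫⁻ x in Ω, ‖b x‖ₑ * ‖f x‖ₑ ≤ ε * ((∫⁻ x in Ω, conjAt Φ x ‖b x‖₊) + 1) := by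
  obtain ⟨_, ⟨c, hc, rfl, hI⟩, hlt⟩ := sInf_lt_iff.1 h
  calc ∫⁻ x in Ω, ‖b x‖ₑ * ‖f x‖ₑ
      ≤ ∫⁻ x in Ω, (c : ℝ≥0∞) * (conjAt Φ x ‖b x‖₊ + Φ x (‖f x‖₊ / c)) := by
        refine lintegral_mono fun x => ?_
        refine le_trans (le_of_eq ?_)
          -- Young's inequality for |b| and |f| / c, multiplied by c.
          (mul_le_mul_right (mul_le_add_conj (Φ x) ‖b x‖₊ (‖f x‖₊ / c)) (c : ℝ≥0∞))
        rw [← ENNReal.coe_mul, enorm_eq_nnnorm, enorm_eq_nnnorm, ← ENNReal.coe_mul]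
        congr 1
        field_simp
    _ = c * ((∫⁻ x in Ω, conjAt Φ x ‖b x‖₊) + ∫⁻ x in Ω, Φ x (‖f x‖₊ / c)) := by
        rw [lintegral_const_mul' _ _ ENNReal.coe_ne_top, lintegral_add_left' hb]
    _ ≤ _ := by gcongr

/-! ### The double phase integrand -/

theorem integrand_mul_le {φ ψ : ℝ≥0 → ℝ≥0∞} (hφ : IsOrlicz φ) (hψ : IsOrlicz ψ) (x : Plane)
    (l : ℝ≥0) (hl : l ≤ 1) (t : ℝ≥0) : integrand φ ψ x (l * t) ≤ l * integrand φ ψ x t := by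
  rw [integrand, integrand, mul_add, mul_left_comm]
  gcongr
  · exact hφ.map_mul_le hl t
  · exact hψ.map_mul_le hl t

theorem measurableSet_phase : MeasurableSet {x : Plane | |x 0| < |x 1|} :=
  (isOpen_lt (by fun_prop) (by fun_prop)).measurableSet

/-- The weight takes two values, so only two conjugates occur, each monotone and hence Borel. -/
theorem measurable_conjAt_integrand (φ ψ : ℝ≥0 → ℝ≥0∞) {b : Plane → Plane} (hb : Measurable b) :
    Measurable fun x => conjAt (integrand φ ψ) x ‖b x‖₊ := by
  classical
  have h : (fun x => conjAt (integrand φ ψ) x ‖b x‖₊) = fun x =>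
      if |x 0| < |x 1| then conj (fun t => φ t + ψ t) ‖b x‖₊ else conj φ ‖b x‖₊ := by
    ext x
    have hx : integrand φ ψ x = fun t => φ t + weight x * ψ t := rfl
    by_cases h : |x 0| < |x 1|
    · simp [conjAt, hx, weight, h]
    · simp [conjAt, hx, weight, h]
  rw [h]
  exact Measurable.ite measurableSet_phase
    ((conj_monotone _).measurable.comp hb.nnnorm) ((conj_monotone _).measurable.comp hb.nnnorm)

theorem nnnorm_le_inv {x y : Plane} (hx : x ≠ 0) (h : ‖x‖ * ‖y‖ ≤ 1) : ‖y‖₊ ≤ ‖x‖₊⁻¹ := by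
  rw [← NNReal.coe_le_coe, NNReal.coe_inv, coe_nnnorm, coe_nnnorm, ← one_div,
    le_div_iff₀ (norm_pos_iff.2 hx), mul_comm]
  exact h

theorem lintegral_integrand_lt_top {φ ψ : ℝ≥0 → ℝ≥0∞} (hφ : IsOrlicz φ) (hψ : IsOrlicz ψ)
    (hφint : FiniteNearZero φ) (hψfin : ∀ t, ψ t ≠ ⊤) {g : Plane → Plane}
    (hg : ∀ x, ‖x‖ * ‖g x‖ ≤ 1) {K : ℝ≥0} (hK : ∀ x : Plane, |x 0| < |x 1| → ‖g x‖₊ ≤ K) :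
    ∫⁻ x in square, integrand φ ψ x ‖g x‖₊ < ⊤ := by
  have h : ∫⁻ x in square, integrand φ ψ x ‖g x‖₊ ≤ ∫⁻ x in square, (φ (‖x‖₊⁻¹) + ψ K) := by
    refine lintegral_mono_ae ?_
    filter_upwards [ae_restrict_of_ae (Measure.ae_ne volume (0 : Plane))] with x hx
    refine add_le_add (hφ.monotone (nnnorm_le_inv hx (hg x))) ?_
    by_cases hx' : |x 0| < |x 1|
    · simpa [weight, hx'] using hψ.monotone (hK x hx')
    · simp [weight, hx']
  refine h.trans_lt ?_
  rw [lintegral_add_right _ measurable_const, ENNReal.add_lt_top]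
  refine ⟨lintegral_square_lt_top hφ.monotone hφint, ?_⟩
  rw [setLIntegral_const]
  exact ENNReal.mul_lt_top (hψfin K).lt_top
    ((measure_mono square_subset_ball).trans_lt measure_ball_lt_top)

theorem lintegral_conjAt_integrand_lt_top {φ ψ : ℝ≥0 → ℝ≥0∞}
    (hψint : FiniteNearZero (conj ψ)) {b : Plane → Plane} (hb : ∀ x, ‖x‖ * ‖b x‖ ≤ 1)
    (hb0 : ∀ x : Plane, x ≠ 0 → |x 1| ≤ |x 0| → b x = 0) :
    ∫⁻ x in square, conjAt (integrand φ ψ) x ‖b x‖₊ < ⊤ := by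
  refine lt_of_le_of_lt (lintegral_mono_ae ?_)
    (lintegral_square_lt_top (conj_monotone ψ) hψint)
  filter_upwards [ae_restrict_of_ae (Measure.ae_ne volume (0 : Plane))] with x hx
  by_cases hx' : |x 0| < |x 1|
  · refine (conj_anti (θ := ψ) (fun t => ?_) _).trans
      (conj_monotone ψ (nnnorm_le_inv hx (hb x)))
    simp [integrand, weight, hx']
  · rw [hb0 x hx (not_lt.1 hx'), nnnorm_zero, conjAt, conj_zero]
    exact zero_le

/-! ### Continuity of the linear functional -/

theorem eq_zero_of_forall_le_mul {a M : ℝ≥0∞} (hM : M ≠ ⊤)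
    (h : ∀ ε : ℝ≥0∞, 0 < ε → a ≤ ε * M) : a = 0 := by
  have h1 := ENNReal.Tendsto.mul_const (b := M) ENNReal.tendsto_inv_nat_nhds_zero (Or.inr hM)
  rw [zero_mul] at h1
  exact le_zero_iff.1 (ge_of_tendsto' h1 fun n =>
    h _ (ENNReal.inv_pos.2 (ENNReal.natCast_ne_top n)))

theorem integrable_inner_gradient_test {Ω : Set Plane} {b : Plane → Plane}
    (hbi : IntegrableOn b Ω) {η : Plane → ℝ} (hη : η ∈ testFunctions Ω) :
    IntegrableOn (fun x => inner ℝ (b x) (gradient η x)) Ω := by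
  obtain ⟨K, hK⟩ := (hη.2.1.fderiv ℝ).exists_bound_of_continuous
    (hη.1.continuous_fderiv (by simp))
  refine Integrable.mono' (hbi.norm.mul_const K)
    (hbi.aestronglyMeasurable.inner (measurable_gradient η).aestronglyMeasurable)
    (.of_forall fun x => (norm_inner_le_norm _ _).trans ?_)
  rw [norm_gradient]
  exact mul_le_mul_of_nonneg_left (hK x) (norm_nonneg _)

theorem enorm_inner_le (x y : Plane) : ‖(inner ℝ x y : ℝ)‖ₑ ≤ ‖x‖ₑ * ‖y‖ₑ := by
  rw [← ofReal_norm, ← ofReal_norm, ← ofReal_norm, ← ENNReal.ofReal_mul (norm_nonneg _)]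
  exact ENNReal.ofReal_le_ofReal (norm_inner_le_norm _ _)

/-- The functional vanishes on test functions and is continuous in the Luxemburg norm by Hölder, so
it vanishes on their closure. -/
theorem integral_inner_weakGrad_eq_zero {Φ : Plane → ℝ≥0 → ℝ≥0∞} {Ω : Set Plane}
    (hΩ : IsOpen Ω) {b : Plane → Plane} (hbi : IntegrableOn b Ω)
    (hbm : Measurable fun x => conjAt Φ x ‖b x‖₊)
    (hbfin : ∫⁻ x in Ω, conjAt Φ x ‖b x‖₊ < ⊤)
    (hdiv : ∀ η ∈ testFunctions Ω, ∫ x in Ω, inner ℝ (b x) (gradient η x) = 0)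
    {u : Plane → ℝ} (hu : u ∈ H1PhiZero Φ Ω) :
    ∫ x in Ω, inner ℝ (b x) (weakGrad Ω u x) = 0 := by
  by_contra hne
  -- The Bochner integral of a non-integrable function is `0`, so a nonzero value already gives
  -- integrability.
  have hinteg : IntegrableOn (fun x => inner ℝ (b x) (weakGrad Ω u x)) Ω :=
    not_imp_comm.1 integral_undef hne
  refine enorm_ne_zero.2 hne (eq_zero_of_forall_le_mul
    (ENNReal.add_lt_top.2 ⟨hbfin, ENNReal.one_lt_top⟩).ne fun ε hε => ?_)
  obtain ⟨η, hη, hlt⟩ := hu.2 ε hε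
  obtain ⟨g, hu', -⟩ := hu.1.1.1.2
  have hg := (hu'.weakGrad).sub
    (hasWeakGradient_of_contDiffOn hΩ hη.1.contDiffOn)
  rw [normW1PhiZero, luxNorm_congr_ae (weakGrad_ae_eq hΩ hg)] at hlt
  refine le_trans ?_ (lintegral_mul_le_of_luxNorm_lt hbm.aemeasurable hlt)
  rw [← sub_zero (∫ x in Ω, inner ℝ (b x) (weakGrad Ω u x)), ← hdiv η hη,
    ← integral_sub hinteg (integrable_inner_gradient_test hbi hη)]
  refine (enorm_integral_le_lintegral_enorm _).trans (lintegral_mono fun x => ?_)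
  rw [← inner_sub_right]
  exact enorm_inner_le _ _

/-! ### Localization: functions smooth inside the square -/

theorem cutoff_mem_testFunctions_square : cutoff 3 ∈ testFunctions square :=
  ⟨cutoff_contDiff 3, cutoff_hasCompactSupport 3, fun x hx => mem_square_of_norm_lt (by
    have h : 4 * ‖x‖ ^ 2 ≤ 3 := tsupport_cutoff hx
    nlinarith [norm_nonneg x])⟩

theorem fderiv_cutoff_eq_zero {x : Plane} (h : 4 * ‖x‖ ^ 2 ≤ 2) : fderiv ℝ (cutoff 3) x = 0 := by
  refine IsLocalMax.fderiv_eq_zero (.of_forall fun y => ?_)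
  rw [cutoff_eq_one (x := x) (by linarith)]
  exact Real.smoothTransition.le_one _

/-- The gradient of `cutoff 3` lives where `1 / 2 ≤ ‖x‖`, away from the singularity of `b`. -/
theorem norm_inner_gradient_cutoff_le {b : Plane → Plane} (hb : ∀ x, ‖x‖ * ‖b x‖ ≤ 1) :
    ∃ K : ℝ≥0, ∀ x, ‖(inner ℝ (b x) (gradient (cutoff 3) x) : ℝ)‖ₑ ≤ K := by
  obtain ⟨K, hK⟩ := gradient_cutoff_bounded 3
  refine ⟨(2 * |K|).toNNReal, fun x => ?_⟩
  rw [← ofReal_norm]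
  refine ENNReal.ofReal_le_ofReal ?_
  rcases le_total (4 * ‖x‖ ^ 2) 2 with h | h
  · simp [gradient, fderiv_cutoff_eq_zero h]
  · refine (norm_inner_le_norm _ _).trans ?_
    have h1 : 1 / 2 ≤ ‖x‖ := by nlinarith [norm_nonneg x]
    have h2 : ‖b x‖ ≤ 2 := by nlinarith [hb x, norm_nonneg (b x)]
    exact mul_le_mul h2 ((hK x).trans (le_abs_self K)) (norm_nonneg _) (by norm_num)

/-- An approximant `u` need not vanish near the boundary, so the field is tested against `cutoff 3 *
u` instead. The extra term, in which the cutoff is differentiated, is controlled by the L^1 part of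
the norm. -/
theorem not_mem_H1Phi {Φ : Plane → ℝ≥0 → ℝ≥0∞} {b : Plane → Plane}
    (hbi : IntegrableOn b square) (hb : ∀ x, ‖x‖ * ‖b x‖ ≤ 1)
    (hbm : Measurable fun x => conjAt Φ x ‖b x‖₊)
    (hbfin : ∫⁻ x in square, conjAt Φ x ‖b x‖₊ < ⊤)
    (hdiv : ∀ η ∈ testFunctions square, ∫ x in square, inner ℝ (b x) (gradient η x) = 0)
    {C : ℝ} {w : Plane → ℝ} (hw : PunctureSmooth C w) (hws : tsupport w ⊆ {x | 4 * ‖x‖ ^ 2 ≤ 2})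
    (hne : ∫ x in square, inner ℝ (b x) (gradient w x) ≠ 0) :
    w ∉ H1Phi Φ square := by
  intro hH
  have hinteg : IntegrableOn (fun x => inner ℝ (b x) (gradient w x)) square :=
    not_imp_comm.1 integral_undef hne
  obtain ⟨K, hK⟩ := norm_inner_gradient_cutoff_le hb
  refine enorm_ne_zero.2 hne (eq_zero_of_forall_le_mul
    (M := ((∫⁻ x in square, conjAt Φ x ‖b x‖₊) + 1) + K)
    (ENNReal.add_lt_top.2 ⟨ENNReal.add_lt_top.2 ⟨hbfin, ENNReal.one_lt_top⟩,
      ENNReal.coe_lt_top⟩).ne fun ε hε => ?_)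
  obtain ⟨u, hu, -, hlt⟩ := hH.2 ε hε
  have hg := (hw.hasWeakGradient square).sub (hasWeakGradient_of_contDiffOn isOpen_square hu)
  rw [normW1Phi, luxNorm_congr_ae (weakGrad_ae_eq isOpen_square hg)] at hlt
  have hlux := lt_of_le_of_lt le_add_self hlt
  have hL1 := lt_of_le_of_lt le_self_add hlt
  rw [eLpNorm_one_eq_lintegral_enorm] at hL1
  have htest := test_mul_contDiff isOpen_square cutoff_mem_testFunctions_square hu
  -- `cutoff 3` equals `1` with zero gradient on the support of `w`, so multiplying `w` by it
  -- changes nothing. The right side is the product rule for `cutoff 3 * (w - u)`.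
  have hpt : ∀ x ∈ square,
      inner ℝ (b x) (gradient w x) - inner ℝ (b x) (gradient (fun y => cutoff 3 y * u y) x) =
        cutoff 3 x * inner ℝ (b x) ((gradient w - gradient u) x) +
          (w - u) x * inner ℝ (b x) (gradient (cutoff 3) x) := by
    intro x hx
    have hprod : gradient (fun y => cutoff 3 y * u y) x =
        cutoff 3 x • gradient u x + u x • gradient (cutoff 3) x := by
      rw [gradient, fderiv_fun_mul ((cutoff_contDiff 3).differentiable (by simp) x)
        ((hu.contDiffAt (isOpen_square.mem_nhds hx)).differentiableAt (by simp)),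
        map_add, map_smul, map_smul]
      rfl
    rw [hprod, inner_add_right, inner_smul_right, inner_smul_right, Pi.sub_apply, Pi.sub_apply,
      inner_sub_right]
    by_cases hxw : 4 * ‖x‖ ^ 2 ≤ 2
    · have h0 : gradient (cutoff 3) x = 0 := by simp [gradient, fderiv_cutoff_eq_zero hxw]
      rw [cutoff_eq_one (by linarith), h0, inner_zero_right]
      ring
    · have hxs : x ∉ tsupport w := fun h => hxw (hws h)
      have h0 : gradient w x = 0 := by
        rw [gradient, image_eq_zero_of_notMem_tsupport
          (fun h => hxs (tsupport_fderiv_subset ℝ h)), map_zero]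
      rw [h0, image_eq_zero_of_notMem_tsupport hxs, inner_zero_right]
      ring
  have hfm : AEStronglyMeasurable (gradient w - gradient u) (volume.restrict square) :=
    ((measurable_gradient w).sub (measurable_gradient u)).aestronglyMeasurable
  rw [← sub_zero (∫ x in square, inner ℝ (b x) (gradient w x)), ← hdiv _ htest,
    ← integral_sub hinteg (integrable_inner_gradient_test hbi htest)]
  calc ‖∫ x in square, (inner ℝ (b x) (gradient w x) -
          inner ℝ (b x) (gradient (fun y => cutoff 3 y * u y) x))‖ₑ
      ≤ ∫⁻ x in square, ‖(inner ℝ (b x) (gradient w x) -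
          inner ℝ (b x) (gradient (fun y => cutoff 3 y * u y) x) : ℝ)‖ₑ :=
        enorm_integral_le_lintegral_enorm _
    _ ≤ ∫⁻ x in square, (‖b x‖ₑ * ‖(gradient w - gradient u) x‖ₑ + ‖(w - u) x‖ₑ * K) := by
        refine setLIntegral_mono' isOpen_square.measurableSet fun x hx => ?_
        rw [hpt x hx]
        refine (enorm_add_le _ _).trans (add_le_add ?_ ?_)
        · rw [enorm_mul]
          refine (mul_le_of_le_one_left zero_le ?_).trans (enorm_inner_le _ _)
          rw [← ofReal_norm, cutoff, Real.norm_of_nonneg (Real.smoothTransition.nonneg _)]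
          exact ENNReal.ofReal_le_one.2 (Real.smoothTransition.le_one _)
        · rw [enorm_mul]
          exact mul_le_mul_right (hK x) _
    _ = (∫⁻ x in square, ‖b x‖ₑ * ‖(gradient w - gradient u) x‖ₑ) +
          (∫⁻ x in square, ‖(w - u) x‖ₑ) * K := by
        have hm : AEMeasurable (fun x => ‖b x‖ₑ * ‖(gradient w - gradient u) x‖ₑ)
            (volume.restrict square) := hbi.aestronglyMeasurable.enorm.mul hfm.enorm
        rw [lintegral_add_left' hm, lintegral_mul_const' _ _ ENNReal.coe_ne_top]
    _ ≤ ε * ((∫⁻ x in square, conjAt Φ x ‖b x‖₊) + 1) + ε * K :=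
        add_le_add (lintegral_mul_le_of_luxNorm_lt hbm.aemeasurable hlux)
          (mul_le_mul_left hL1.le _)
    _ = _ := (mul_add _ _ _).symm

end DoublePhase

/-! ### Conclusion: strict inclusions and the gap -/

theorem mainTheorem3
    (φ ψ : ℝ≥0 → ℝ≥0∞) (hφ : IsOrlicz φ) (hψ : IsOrlicz ψ)
    (hφΔ : Delta2 φ) (hφN : Nabla2 φ) (hψΔ : Delta2 ψ) (hψN : Nabla2 ψ)
    (p q : ℝ) (hp : 1 < p) (hpq : p ≤ q)
    (hφpq : PowerGrowth p q φ) (hψpq : PowerGrowth p q ψ)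
    (hle : ∃ c₃ c₄ : ℝ≥0, ∀ t, φ t ≤ c₃ * ψ t + c₄)
    (hlim : Tendsto (fun t => φ t / ψ t) atTop (𝓝 0))
    (hφint : FiniteNearZero φ) (hψint : FiniteNearZero (conj ψ)) :
    H1Phi (integrand φ ψ) square ≠ W1Phi (integrand φ ψ) square ∧
    H1PhiZero (integrand φ ψ) square ≠ W1PhiZero (integrand φ ψ) square ∧
    ∃ b : Plane → Plane, MemLPhi (conjAt (integrand φ ψ)) square b ∧
      sInf (functionalG (integrand φ ψ) square b '' W1PhiZero (integrand φ ψ) square) <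
        sInf (functionalG (integrand φ ψ) square b '' H1PhiZero (integrand φ ψ) square) := by
  have hψfin : ∀ t, ψ t ≠ ⊤ := by
    obtain ⟨c₀, c₁, c₂, -, h⟩ := hψpq
    exact fun t => ((h t).2.trans_lt ENNReal.coe_lt_top).ne
  obtain ⟨w, b, ⟨C, hw⟩, hws, hwg, ⟨K, hK⟩, hbmeas, hbi, hb, hb0, hdiv, hneg⟩ :=
    exists_competitor_field
  set Φ := integrand φ ψ with hΦ
  have hE : ∫⁻ x in square, Φ x ‖gradient w x‖₊ < ⊤ :=
    lintegral_integrand_lt_top hφ hψ hφint hψfin hwg hK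
  have hJ : ∫⁻ x in square, conjAt Φ x ‖b x‖₊ < ⊤ :=
    lintegral_conjAt_integrand_lt_top hψint hb hb0
  have hbm := measurable_conjAt_integrand φ ψ hbmeas
  have hgw := weakGrad_ae_eq isOpen_square (hw.hasWeakGradient square)
  have hwsq : tsupport w ⊆ square := fun x hx => mem_square_of_norm_lt (by
    have h : 4 * ‖x‖ ^ 2 ≤ 2 := hws hx
    nlinarith [norm_nonneg x])
  have hwc : HasCompactSupport w :=
    (cutoff_hasCompactSupport 3).of_isClosed_subset (isClosed_tsupport w)
      (fun x hx => subset_tsupport _ (by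
        have h : 4 * ‖x‖ ^ 2 ≤ 2 := hws hx
        simp [cutoff_eq_one (a := 3) (x := x) (by linarith)]))
  have hW11 := hw.mem_W11zero isOpen_square hwc hwsq
  have hmem : MemLPhi Φ square (weakGrad square w) := by
    refine ⟨(measurable_gradient w).aestronglyMeasurable.congr hgw.symm, ?_⟩
    rw [luxNorm_congr_ae hgw]
    exact luxNorm_lt_top (integrand_mul_le hφ hψ) one_pos (by simpa using hE)
  have hG : ∫ x in square, inner ℝ (b x) (weakGrad square w x) =
      ∫ x in square, inner ℝ (b x) (gradient w x) := by
    refine integral_congr_ae ?_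
    filter_upwards [hgw] with x hx
    rw [hx]
  have hzero : ∀ u ∈ H1PhiZero Φ square, ∫ x in square, inner ℝ (b x) (weakGrad square u x) = 0 :=
    fun u hu => integral_inner_weakGrad_eq_zero isOpen_square hbi hbm hJ hdiv hu
  refine ⟨fun h => ?_, fun h => ?_, ?_⟩
  · have hwW : w ∈ W1Phi Φ square := ⟨hW11.1, hmem⟩
    rw [← h] at hwW
    exact not_mem_H1Phi hbi hb hbm hJ hdiv hw hws hneg.ne hwW
  · have hwW : w ∈ W1PhiZero Φ square := ⟨hW11, hmem⟩
    rw [← h] at hwW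
    exact hneg.ne (hG ▸ hzero w hwW)
  · set E := ∫⁻ x in square, Φ x ‖gradient w x‖₊
    set I := ∫ x in square, inner ℝ (b x) (gradient w x)
    -- With this multiple of `b`, the linear term at `w` is -(E + 1), so the functional takes the
    -- value -1 there.
    set t : ℝ := (E.toReal + 1) / -I with ht
    have hE0 : 0 ≤ E.toReal := ENNReal.toReal_nonneg
    have htpos : 0 < t := div_pos (by linarith) (by linarith)
    refine ⟨fun x => t • b x, ⟨(hbmeas.const_smul t).aestronglyMeasurable, ?_⟩, ?_⟩
    · refine luxNorm_lt_top (fun x l hl s => conj_mul_le _ hl s) (Real.toNNReal_pos.2 htpos) ?_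
      refine lt_of_le_of_lt (le_of_eq (lintegral_congr fun x => ?_)) hJ
      congr 1
      rw [nnnorm_smul, ← norm_toNNReal (a := t), Real.norm_of_nonneg htpos.le,
        mul_div_cancel_left₀ _ (Real.toNNReal_pos.2 htpos).ne']
    · have hscale : ∀ u : Plane → ℝ,
          ∫ x in square, inner ℝ (t • b x) (weakGrad square u x) =
            t * ∫ x in square, inner ℝ (b x) (weakGrad square u x) := fun u => by
        simp only [real_inner_smul_left]
        exact integral_const_mul _ _
      have hval : functionalG Φ square (fun x => t • b x) w < 0 := by
        have hE' : ∫⁻ x in square, Φ x ‖weakGrad square w x‖₊ = E := by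
          refine lintegral_congr_ae ?_
          filter_upwards [hgw] with x hx
          rw [hx]
        have hEr : (E : EReal) = ((E.toReal : ℝ) : EReal) := (EReal.coe_ennreal_toReal hE.ne).symm
        have htI : t * I = -(E.toReal + 1) := by
          rw [ht]
          field_simp [hneg.ne]
        rw [functionalG, hE', hscale, hG, hEr, htI, ← EReal.coe_add, ← EReal.coe_zero,
          EReal.coe_lt_coe_iff]
        linarith
      refine lt_of_le_of_lt (sInf_le ⟨w, ⟨hW11, hmem⟩, rfl⟩) (lt_of_lt_of_le hval ?_)
      refine le_sInf ?_
      rintro _ ⟨u, hu, rfl⟩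
      rw [functionalG, hscale, hzero u hu, mul_zero, EReal.coe_zero, add_zero]
      exact EReal.coe_ennreal_nonneg _
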